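/- Let $p>2$ be a prime, fix an algebraic closure $\mathbb Q_p^{\mathrm{alg}}$ of $\mathbb Q_p$, and write $g^{\circ n}$ for the $n$-fold iterate of a power series $g$ under composition, with $g^{\circ 0}=x$. Let $f,u\in\mathbb Z_p[[x]]$ be a minimal commuting pair, that is: $f(0)=u(0)=0$; $f'(0)\neq 0$ and $u'(0)\ne 0$; $f\circ u=u\circ f$; $f'(0)\notin\mathbb Z_p^\times$; $u'(0)\in\mathbb Z_p^\times$ and $u^{\circ n}\neq x$ for all $n\ge 1$; the reduction of $f$ modulo $p$ has order of vanishing exactly $p$ at $x=0$; and $v_p(f'(0))=v_p(u'(0)-1)=1$. For $n\ge 0$ let $\Lambda_f(n)$ be the set of $\pi\in\mathbb Q_p^{\mathrm{alg}}$ with $|\pi|<1$ and $f^{\circ n}(\pi)=0$, let $\Lambda_f=\bigcup_{n\ge 0}\Lambda_f(n)$, $K_n=\mathbb Q_p(\Lambda_f(n))$ and $K=\mathbb Q_p(\Lambda_f)$. Suppose that $\mathbb Q_p(\pi)/\mathbb Q_p$ is Galois for every $\pi\in\Lambda_f$. Then: (1) $K/\mathbb Q_p$ is Galois and $\mathfrak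 G=\mathrm{Gal}(K/\mathbb Q_p)$ is isomorphic, as a topological group, to $\mathbb Z/(p-1)\times\mathbb Z_p$; in particular $\mathfrak G$ is abelian. (2) For every $n\ge 1$, $K_n/\mathbb Q_p$ is Galois and $\mathfrak G_n=\mathrm{Gal}(K_n/\mathbb Q_p)\cong\mathbb Z/(p-1)\times\mathbb Z/p^{n-1}$. (3) $\mathfrak G$ has an element of order $p-1$, and there is a sequence $(\pi_n)_{n\ge 0}$ in $\Lambda_f$ with $\pi_0=0$, $\pi_1\ne 0$ and $f(\pi_{n+1})=\pi_n$ for all $n\geq 0$. For every such sequence there is a unique $\mathfrak u\in\mathfrak G$ with $\mathfrak u(\pi_n)=u(\pi_n)$ for all $n\ge 0$; and every $\mathfrak w\in\mathfrak G$ of order $p-1$ commutes with $\mathfrak u$, and there is an isomorphism of topological groups $\mathfrak G\to\mathbb Z/(p-1)\times\mathbb Z_p$ with $\mathfrak w\mapsto(1,0)$ and $\mathfrak u\mapsto(0,1)$. -/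

import Mathlib

open PowerSeries

noncomputable section

namespace CommutingPair

/-- Composition `g ∘ h` of power series; it is only applied when `h` has no constant term. -/
def comp {R : Type*} [CommRing R] (g h : R⟦X⟧) : R⟦X⟧ := PowerSeries.subst h g

/-- The `n`-fold iterate `g^{∘ n}` under composition, with `g^{∘ 0} = x`. -/
def iter {R : Type*} [CommRing R] (g : R⟦X⟧) : ℕ → R⟦X⟧
  | 0 => X
  | n + 1 => comp (iter g n) g

/-- The set `S₀(R)` of power series with `g(0) = 0` and `g'(0) ≠ 0`. -/
def S₀ (R : Type*) [CommRing R] : Set R⟦X⟧ :=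
  {g | coeff 0 g = 0 ∧ coeff 1 g ≠ 0}

/-- A commuting pair in `S₀(R)`: `f` is noninvertible, `u` is invertible and nontorsion under
composition, and `f ∘ u = u ∘ f`. -/
structure IsCommutingPair {R : Type*} [CommRing R] (f u : R⟦X⟧) : Prop where
  f_mem : f ∈ S₀ R
  u_mem : u ∈ S₀ R
  not_isUnit : ¬ IsUnit (coeff 1 f)
  isUnit : IsUnit (coeff 1 u)
  nontorsion : ∀ n : ℕ, 0 < n → iter u n ≠ X
  comm : comp f u = comp u f

variable {p : ℕ} [Fact p.Prime]

/-- The Weierstrass degree of a power series over `ℤ_p`: the order of its reduction mod `p`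
(which is `⊤` if the reduction vanishes). -/
def wideg (g : ℤ_[p]⟦X⟧) : ℕ∞ := (PowerSeries.map (PadicInt.toZMod (p := p)) g).order

/-- A minimal commuting pair over `ℤ_p`. -/
structure IsMinimalCommutingPair (f u : ℤ_[p]⟦X⟧) : Prop extends IsCommutingPair f u where
  wideg_eq : wideg f = p
  valuation_f : (coeff 1 f).valuation = 1
  valuation_u : (coeff 1 u - 1).valuation = if p = 2 then 2 else 1

/-- `g(x) = y`: the series `∑ aᵢ xⁱ` converges in the algebraic closure of `ℚ_p` (with the
`p`-adic topology) and its sum is `y`. -/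
def HasValueAt (g : ℤ_[p]⟦X⟧) (x y : PadicAlgCl p) : Prop :=
  HasSum (fun i : ℕ => algebraMap ℚ_[p] (PadicAlgCl p) (coeff i g : ℤ_[p]) * x ^ i) y

/-- `Λ_f(n)`: the roots of `f^{∘ n}` in the open unit disc of the algebraic closure of `ℚ_p`. -/
def Lam (f : ℤ_[p]⟦X⟧) (n : ℕ) : Set (PadicAlgCl p) :=
  {x | ‖x‖ < 1 ∧ HasValueAt (iter f n) x 0}

/-- `Λ_f`, the union of all `Λ_f(n)`. -/
def LamAll (f : ℤ_[p]⟦X⟧) : Set (PadicAlgCl p) := ⋃ n, Lam f n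

/-- `K_n = ℚ_p(Λ_f(n))`. -/
abbrev Kn (f : ℤ_[p]⟦X⟧) (n : ℕ) : IntermediateField ℚ_[p] (PadicAlgCl p) :=
  IntermediateField.adjoin ℚ_[p] (Lam f n)

/-- `K = ℚ_p(Λ_f)`. -/
abbrev K (f : ℤ_[p]⟦X⟧) : IntermediateField ℚ_[p] (PadicAlgCl p) :=
  IntermediateField.adjoin ℚ_[p] (LamAll f)

/-- An `f`-consistent sequence of elements of `Λ_f`. -/
structure IsConsistent (f : ℤ_[p]⟦X⟧) (π : ℕ → PadicAlgCl p) : Prop where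
  mem : ∀ n, π n ∈ LamAll f
  zero : π 0 = 0
  one_ne : π 1 ≠ 0
  step : ∀ n, HasValueAt f (π (n + 1)) (π n)

theorem IsConsistent.mem_K {f : ℤ_[p]⟦X⟧} {π : ℕ → PadicAlgCl p} (h : IsConsistent f π) (n : ℕ) :
    π n ∈ K f :=
  IntermediateField.subset_adjoin _ _ (h.mem n)

/-- The automorphism `σ` of `K` acts on the consistent sequence `π` through the series `u`:
`σ(π_n) = u(π_n)` for all `n`. -/
def ActsThrough {f : ℤ_[p]⟦X⟧} (u : ℤ_[p]⟦X⟧) {π : ℕ → PadicAlgCl p} (h : IsConsistent f π)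
    (σ : Gal(K f/ℚ_[p])) : Prop :=
  ∀ n, HasValueAt u (π n) (σ ⟨π n, h.mem_K n⟩ : K f)

end CommutingPair

end

open CommutingPair

namespace CommutingPair

variable {p : ℕ} [Fact p.Prime]

/-! ### Evaluation of integral power series on the open unit disc -/

/-! The hypotheses give `f = x (p A + x^(p-1) B)` with units `A`, `B`. Newton-polygon estimates and
Weierstrass preparation then show that the roots of exact level `n + 1` (the set `Prim f n`) are the
roots of one polynomial `Q_n` of degree `p^n (p-1)`. They satisfy `‖x‖^(p^n (p-1)) = 1/p`, so they
are conjugate uniformizers of totally ramified extensions. If every `ℚ_p(π)` is Galois, one root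
generates all roots of its level and of the lower levels. The stabilizers `H n` of `π_(n+1)` are
therefore open normal subgroups of index `p^n (p-1)` with trivial intersection.

Since `u` commutes with `f` and `u'(0) ≡ 1` mod `p`, it permutes each level; conjugacy and
compactness give `𝔲` with `𝔲(π_n) = u(π_n)`. Distinct nonzero roots of `f` are too far apart for `u`
to move them, so `𝔲 ∈ H 0`. If `𝔲^k` fixes `π_(n+1)`, then `(u^{∘k} - x)/x` vanishes on the first `n
+ 1` levels, whence `p^(n+1) ∣ u'(0)^k - 1`, and `p^n ∣ k` by lifting the exponent. Thus `𝔲`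
topologically generates `H 0 ≅ ℤ_p`. The tame character `σ ↦ σ(π_1)/π_1` makes `𝔊 / H 0` cyclic of
order `p - 1`, and a generator lifts to an element `𝔴` of order `p - 1`.

It remains to see that `𝔴` centralizes `𝔲` (`IsTameWild.commute_of_pow_eq_one`). At level two or
higher `|u(x) - x| = |x|^p`, and conjugation by `σ` changes the leading coefficient of `u(x) - x` by
the factor `(σx/x)^(p-1)`, which is `1` in the residue field `𝔽_p` (`norm_conj_sub_lt`). So `𝔴𝔲𝔴⁻¹`
is a power of `𝔲` with exponent `≡ 1` mod `p`; as this exponent also has order dividing `p - 1`, it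
is `1`. -/

theorem norm_algebraMap_le_one (a : ℤ_[p]) : ‖algebraMap ℤ_[p] (PadicAlgCl p) a‖ ≤ 1 := by
  change ‖algebraMap ℚ_[p] (PadicAlgCl p) (a : ℚ_[p])‖ ≤ 1
  rw [norm_algebraMap']
  exact a.2

theorem norm_algebraMap_padicInt (a : ℤ_[p]) : ‖algebraMap ℤ_[p] (PadicAlgCl p) a‖ = ‖a‖ := by
  change ‖algebraMap ℚ_[p] (PadicAlgCl p) (a : ℚ_[p])‖ = ‖a‖
  rw [norm_algebraMap']
  rfl

theorem norm_galois (σ : Gal(PadicAlgCl p/ℚ_[p])) (x : PadicAlgCl p) : ‖σ x‖ = ‖x‖ :=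
  (spectralNorm_eq_of_equiv σ x).symm

theorem norm_sub_le_max' (x y : PadicAlgCl p) : ‖x - y‖ ≤ max ‖x‖ ‖y‖ := by
  simpa [sub_eq_add_neg] using IsUltrametricDist.norm_add_le_max x (-y)

theorem norm_add_lt {x y : PadicAlgCl p} {r : ℝ} (hx : ‖x‖ < r) (hy : ‖y‖ < r) : ‖x + y‖ < r :=
  (IsUltrametricDist.norm_add_le_max x y).trans_lt (max_lt hx hy)

theorem norm_sub_lt {x y : PadicAlgCl p} {r : ℝ} (hx : ‖x‖ < r) (hy : ‖y‖ < r) : ‖x - y‖ < r :=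
  (norm_sub_le_max' x y).trans_lt (max_lt hx hy)

theorem norm_eq_of_norm_sub_lt {x y : PadicAlgCl p} (h : ‖x - y‖ < ‖y‖) : ‖x‖ = ‖y‖ := by
  have := IsUltrametricDist.norm_add_eq_max_of_norm_ne_norm h.ne
  rwa [sub_add_cancel, max_eq_right h.le] at this

section Complete

variable {F : Type*} [NormedField F] (c : ℤ_[p] →+* F) (hc : ∀ a, ‖c a‖ ≤ 1)

include hc in
theorem summable_norm_eval {x : F} (hx : ‖x‖ < 1) (g : ℤ_[p]⟦X⟧) :
    Summable fun i : ℕ => ‖c (coeff i g) * x ^ i‖ := by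
  refine Summable.of_nonneg_of_le (fun _ => norm_nonneg _) (fun i => ?_)
    (summable_geometric_of_lt_one (norm_nonneg x) hx)
  rw [norm_mul, norm_pow]
  exact mul_le_of_le_one_left (by positivity) (hc _)

include hc in
theorem tsum_eval_mul [CompleteSpace F] {x : F} (hx : ‖x‖ < 1) (g h : ℤ_[p]⟦X⟧) :
    ∑' i : ℕ, c (coeff i (g * h)) * x ^ i =
      (∑' i : ℕ, c (coeff i g) * x ^ i) * ∑' i : ℕ, c (coeff i h) * x ^ i := by
  rw [tsum_mul_tsum_eq_tsum_sum_antidiagonal_of_summable_norm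
    (summable_norm_eval c hc hx g) (summable_norm_eval c hc hx h)]
  refine tsum_congr fun n => ?_
  rw [coeff_mul, map_sum, Finset.sum_mul]
  refine Finset.sum_congr rfl fun kl hkl => ?_
  rw [← Finset.HasAntidiagonal.mem_antidiagonal.mp hkl, map_mul, pow_add]
  ring

end Complete

/-- The value `g(x)` of a power series. -/
noncomputable def ev (x : PadicAlgCl p) (g : ℤ_[p]⟦X⟧) : PadicAlgCl p :=
  ∑' i : ℕ, algebraMap ℤ_[p] (PadicAlgCl p) (coeff i g) * x ^ i

instance finiteDimensional_adjoin_singleton (x : PadicAlgCl p) :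
    FiniteDimensional ℚ_[p] (IntermediateField.adjoin ℚ_[p] {x}) :=
  IntermediateField.adjoin.finiteDimensional (Algebra.IsIntegral.isIntegral x)

/-- The algebraic closure is not complete, so convergence and the Cauchy product are obtained in the
complete finite extension `ℚ_p(x)`. This also places the value `g(x)` in `ℚ_p(x)`. -/
theorem exists_ev_adjoin {x : PadicAlgCl p} (hx : ‖x‖ < 1) :
    ∃ e : ℤ_[p]⟦X⟧ → IntermediateField.adjoin ℚ_[p] {x},
      (∀ g, HasValueAt g x (e g)) ∧ ∀ g h, e (g * h) = e g * e h := by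
  let E := IntermediateField.adjoin ℚ_[p] {x}
  have : CompleteSpace E := FiniteDimensional.complete ℚ_[p] E
  let c : ℤ_[p] →+* E := (algebraMap ℚ_[p] E).comp (algebraMap ℤ_[p] ℚ_[p])
  have hc : ∀ a, ‖c a‖ ≤ 1 := norm_algebraMap_le_one
  let xE : E := ⟨x, IntermediateField.mem_adjoin_simple_self ℚ_[p] x⟩
  have hxE : ‖xE‖ < 1 := hx
  refine ⟨fun g => ∑' i : ℕ, c (coeff i g) * xE ^ i, fun g => ?_, fun g h => ?_⟩
  · have h := (summable_norm_eval c hc hxE g).of_norm.hasSum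
    exact h.map (E.val : E →+ PadicAlgCl p) continuous_subtype_val
  · exact tsum_eval_mul c hc hxE g h

section

variable {x : PadicAlgCl p} (hx : ‖x‖ < 1)

include hx

theorem hasValueAt_ev (g : ℤ_[p]⟦X⟧) : HasValueAt g x (ev x g) := by
  obtain ⟨e, he, -⟩ := exists_ev_adjoin hx
  exact (he g).summable.hasSum

theorem hasValueAt_iff {g : ℤ_[p]⟦X⟧} {y : PadicAlgCl p} : HasValueAt g x y ↔ ev x g = y :=
  ⟨fun h => (hasValueAt_ev hx g).unique h, fun h => h ▸ hasValueAt_ev hx g⟩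

theorem ev_mem_adjoin (g : ℤ_[p]⟦X⟧) : ev x g ∈ IntermediateField.adjoin ℚ_[p] {x} := by
  obtain ⟨e, he, -⟩ := exists_ev_adjoin hx
  rw [(hasValueAt_iff hx).mp (he g)]
  exact (e g).2

theorem ev_mul (g h : ℤ_[p]⟦X⟧) : ev x (g * h) = ev x g * ev x h := by
  obtain ⟨e, he, hm⟩ := exists_ev_adjoin hx
  simp only [fun g => (hasValueAt_iff hx).mp (he g), hm]
  rfl

theorem ev_add (g h : ℤ_[p]⟦X⟧) : ev x (g + h) = ev x g + ev x h := by
  refine (hasValueAt_iff hx).mp ?_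
  have := HasSum.add (hasValueAt_ev hx g) (hasValueAt_ev hx h)
  simpa only [HasValueAt, map_add, PadicInt.coe_add, add_mul] using this

end

theorem ev_coe (x : PadicAlgCl p) (q : Polynomial ℤ_[p]) :
    ev x (q : ℤ_[p]⟦X⟧) = Polynomial.aeval x q := by
  rw [Polynomial.aeval_eq_sum_range, ev, tsum_eq_sum (s := Finset.range (q.natDegree + 1))]
  · simp [Algebra.smul_def]
  · intro i hi
    rw [Polynomial.coeff_coe, Polynomial.coeff_eq_zero_of_natDegree_lt (by simpa using hi)]
    simp

@[simp] theorem ev_C (x : PadicAlgCl p) (a : ℤ_[p]) :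
    ev x (C a) = algebraMap ℤ_[p] (PadicAlgCl p) a := by
  rw [← Polynomial.coe_C, ev_coe, Polynomial.aeval_C]

@[simp] theorem ev_X (x : PadicAlgCl p) : ev x X = x := by
  rw [← Polynomial.coe_X, ev_coe, Polynomial.aeval_X]

/-- Evaluation at a point of the open unit disc, as a ring homomorphism. -/
noncomputable def evHom {x : PadicAlgCl p} (hx : ‖x‖ < 1) : ℤ_[p]⟦X⟧ →+* PadicAlgCl p where
  toFun := ev x
  map_one' := by rw [← map_one (C (R := ℤ_[p])), ev_C, map_one]
  map_mul' := ev_mul hx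
  map_zero' := by rw [← map_zero (C (R := ℤ_[p])), ev_C, map_zero]
  map_add' := ev_add hx

theorem evHom_apply {x : PadicAlgCl p} (hx : ‖x‖ < 1) (g : ℤ_[p]⟦X⟧) : evHom hx g = ev x g := rfl

section

variable {x : PadicAlgCl p} (hx : ‖x‖ < 1)

include hx

theorem ev_sub (g h : ℤ_[p]⟦X⟧) : ev x (g - h) = ev x g - ev x h := map_sub (evHom hx) g h

theorem ev_pow (g : ℤ_[p]⟦X⟧) (n : ℕ) : ev x (g ^ n) = ev x g ^ n := map_pow (evHom hx) g n

theorem norm_ev_le_one (g : ℤ_[p]⟦X⟧) : ‖ev x g‖ ≤ 1 := by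
  refine IsUltrametricDist.norm_tsum_le_of_forall_le_of_nonneg zero_le_one fun i => ?_
  rw [norm_mul, norm_pow]
  exact mul_le_one₀ (norm_algebraMap_le_one _) (by positivity) (pow_le_one₀ (norm_nonneg _) hx.le)

theorem norm_ev_eq_one {g : ℤ_[p]⟦X⟧} (hg : IsUnit g) : ‖ev x g‖ = 1 := by
  obtain ⟨h, hh⟩ := hg.exists_right_inv
  have h1 : ‖ev x g‖ * ‖ev x h‖ = 1 := by
    rw [← norm_mul, ← ev_mul hx, hh, ← map_one (C (R := ℤ_[p])), ev_C]
    simp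
  have h2 := norm_ev_le_one hx g
  have h3 := norm_ev_le_one hx h
  nlinarith [norm_nonneg (ev x g), norm_nonneg (ev x h)]

theorem norm_ev_le {g : ℤ_[p]⟦X⟧} (hg : coeff 0 g = 0) : ‖ev x g‖ ≤ ‖x‖ := by
  obtain ⟨h, rfl⟩ := X_dvd_iff.mpr (by simpa using hg)
  rw [ev_mul hx, ev_X, norm_mul]
  exact mul_le_of_le_one_right (norm_nonneg _) (norm_ev_le_one hx h)

end

theorem ev_at_zero (g : ℤ_[p]⟦X⟧) :
    ev 0 g = algebraMap ℤ_[p] (PadicAlgCl p) (coeff 0 g) := by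
  rw [ev, tsum_eq_single 0]
  · simp
  · intro i hi
    simp [hi]

/-- A ring homomorphism into the closed unit disc which is compatible with scalars and sends `X`
into the open unit disc is an evaluation. -/
theorem ringHom_eq_ev (φ : ℤ_[p]⟦X⟧ →+* PadicAlgCl p)
    (hC : ∀ a, φ (C a) = algebraMap ℤ_[p] (PadicAlgCl p) a) (hφ : ∀ g, ‖φ g‖ ≤ 1)
    (hX : ‖φ X‖ < 1) (g : ℤ_[p]⟦X⟧) : φ g = ev (φ X) g := by
  -- Truncating at degree `n`: the two maps agree on polynomials, and the tails have size at most
  -- `‖φ X‖ ^ n`.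
  have key : ∀ n : ℕ, ‖φ g - ev (φ X) g‖ ≤ ‖φ X‖ ^ n := by
    intro n
    obtain ⟨h, q, hg⟩ : ∃ (h : ℤ_[p]⟦X⟧) (q : Polynomial ℤ_[p]), g = X ^ n * h + (q : ℤ_[p]⟦X⟧) :=
      ⟨_, _, eq_X_pow_mul_shift_add_trunc n g⟩
    have hq : φ q = ev (φ X) (q : ℤ_[p]⟦X⟧) := by
      induction q using Polynomial.induction_on' generalizing g with
      | add a b ha hb =>
        rw [Polynomial.coe_add, map_add, ev_add hX, ha _ rfl, hb _ rfl]
      | monomial i a =>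
        rw [ev_coe, Polynomial.aeval_monomial, ← Polynomial.C_mul_X_pow_eq_monomial,
          Polynomial.coe_mul, Polynomial.coe_pow, Polynomial.coe_C, Polynomial.coe_X, map_mul,
          map_pow, hC]
    rw [hg, map_add, ev_add hX, hq, add_sub_add_right_eq_sub, map_mul, ev_mul hX, map_pow,
      ev_pow hX, ev_X, ← mul_sub, norm_mul, norm_pow]
    refine mul_le_of_le_one_right (by positivity) ?_
    exact (norm_sub_le_max' _ _).trans (max_le (hφ h) (norm_ev_le_one hX h))
  have : ‖φ g - ev (φ X) g‖ ≤ 0 :=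
    ge_of_tendsto' (tendsto_pow_atTop_nhds_zero_of_lt_one (norm_nonneg _) hX) key
  exact sub_eq_zero.mp (norm_le_zero_iff.mp this)

/-- Substituting `h` and then evaluating at `x` is a bounded ring homomorphism, so `ringHom_eq_ev`
identifies it as evaluation at the image of `X`. No double series has to be rearranged. -/
theorem ev_comp {x : PadicAlgCl p} (hx : ‖x‖ < 1) (g : ℤ_[p]⟦X⟧) {h : ℤ_[p]⟦X⟧}
    (hh : coeff 0 h = 0) : ev x (comp g h) = ev (ev x h) g := by
  have hs : HasSubst h := HasSubst.of_constantCoeff_zero' (by simpa using hh)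
  let φ : ℤ_[p]⟦X⟧ →+* PadicAlgCl p :=
    (evHom hx).comp (substAlgHom (R := ℤ_[p]) hs : ℤ_[p]⟦X⟧ →+* ℤ_[p]⟦X⟧)
  have hφ : ∀ g, φ g = ev x (comp g h) := fun g => by
    simp [φ, comp, coe_substAlgHom, evHom_apply]
  have hX : φ X = ev x h := by rw [hφ, comp, subst_X hs]
  rw [← hφ, ← hX]
  refine ringHom_eq_ev φ (fun a => ?_) (fun g => ?_) ?_ g
  · rw [hφ, comp, subst_C]
    exact ev_C x a
  · rw [hφ]
    exact norm_ev_le_one hx _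
  · rw [hX]
    exact (norm_ev_le hx hh).trans_lt hx

theorem galois_ev (σ : Gal(PadicAlgCl p/ℚ_[p])) {x : PadicAlgCl p} (hx : ‖x‖ < 1)
    (g : ℤ_[p]⟦X⟧) : σ (ev x g) = ev (σ x) g := by
  have hσx : ‖σ x‖ < 1 := by rwa [norm_galois]
  have h := ringHom_eq_ev ((σ : PadicAlgCl p →+* PadicAlgCl p).comp (evHom hx))
    (fun a => ?_) (fun g => ?_) ?_ g
  · simpa [evHom_apply] using h
  · rw [RingHom.comp_apply, evHom_apply, ev_C]
    exact σ.commutes (a : ℚ_[p])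
  · simpa [evHom_apply, norm_galois] using norm_ev_le_one hx g
  · simpa [evHom_apply] using hσx

theorem coeff_zero_iter {g : ℤ_[p]⟦X⟧} (hg : coeff 0 g = 0) (n : ℕ) : coeff 0 (iter g n) = 0 := by
  induction n with
  | zero => simp [iter]
  | succ n ih =>
    have h0 : constantCoeff g = 0 := by simpa using hg
    have h1 : constantCoeff (iter g n) = 0 := by simpa using ih
    rw [coeff_zero_eq_constantCoeff_apply]
    exact constantCoeff_subst_eq_zero h0 (iter g n) h1

theorem ev_iter {g : ℤ_[p]⟦X⟧} (hg : coeff 0 g = 0) (n : ℕ) {x : PadicAlgCl p} (hx : ‖x‖ < 1) :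
    ev x (iter g n) = (fun y => ev y g)^[n] x := by
  induction n generalizing x with
  | zero => simp [iter]
  | succ n ih =>
    rw [iter, ev_comp hx _ hg, ih ((norm_ev_le hx hg).trans_lt hx), Function.iterate_succ_apply]

end CommutingPair

namespace CommutingPair

variable {p : ℕ} [Fact p.Prime]

/-! ### Totally ramified elements -/

theorem inv_prime_pos : 0 < (p : ℝ)⁻¹ := inv_pos.mpr (Nat.cast_pos.mpr (Fact.out : p.Prime).pos)

theorem inv_prime_lt_one : (p : ℝ)⁻¹ < 1 :=
  inv_lt_one_of_one_lt₀ (Nat.one_lt_cast.mpr (Fact.out : p.Prime).one_lt)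

theorem norm_natCast_prime : ‖(p : PadicAlgCl p)‖ = (p : ℝ)⁻¹ := by
  rw [← map_natCast (algebraMap ℚ_[p] (PadicAlgCl p)), norm_algebraMap', Padic.norm_p]

section Uniformizer

variable {π : PadicAlgCl p} {N : ℕ} (hπ : ‖π‖ ^ N = (p : ℝ)⁻¹)

include hπ

theorem norm_pos_of_pow_eq (hN : N ≠ 0) : 0 < ‖π‖ := by
  refine (norm_nonneg π).lt_of_ne fun h => ?_
  rw [← h, zero_pow hN] at hπ
  exact inv_prime_pos.ne hπ

theorem norm_lt_one_of_pow_eq : ‖π‖ < 1 := by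
  by_contra! h
  exact (inv_prime_lt_one (p := p)).not_ge (hπ ▸ one_le_pow₀ h)

theorem ne_zero_of_pow_eq : N ≠ 0 := by
  rintro rfl
  rw [pow_zero] at hπ
  exact (inv_prime_lt_one (p := p)).ne' hπ

/-- The `N`-th power of the norm of `a • π ^ i` is `p` to the exponent `-(v(a) N + i)`, which
determines `i` modulo `N`. -/
theorem eq_of_norm_smul_pow_eq {a b : ℚ_[p]} (ha : a ≠ 0) (hb : b ≠ 0) {i j : ℕ} (hi : i < N)
    (hj : j < N) (h : ‖a • π ^ i‖ = ‖b • π ^ j‖) : i = j := by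
  have hp0 : (0 : ℝ) < p := Nat.cast_pos.mpr (Fact.out : p.Prime).pos
  have hp1 : (1 : ℝ) < p := Nat.one_lt_cast.mpr (Fact.out : p.Prime).one_lt
  have key : ∀ (c : ℚ_[p]) (_ : c ≠ 0) (k : ℕ),
      ‖c • π ^ k‖ ^ N = (p : ℝ) ^ (-(c.valuation * N + k) : ℤ) := by
    intro c hc k
    rw [norm_smul, mul_pow, norm_pow, ← pow_mul, mul_comm k, pow_mul, hπ,
      Padic.norm_eq_zpow_neg_valuation hc, ← zpow_natCast, ← zpow_mul, inv_pow, ← zpow_natCast,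
      ← zpow_neg, ← zpow_add₀ hp0.ne']
    congr 1
    ring
  have h2 : (p : ℝ) ^ (-(a.valuation * N + i) : ℤ) = (p : ℝ) ^ (-(b.valuation * N + j) : ℤ) := by
    rw [← key a ha, ← key b hb, h]
  have h3 := zpow_right_injective₀ hp0 hp1.ne' h2
  have h4 : (i : ℤ) = j + (b.valuation - a.valuation) * N := by linarith
  have h5 : (i : ℤ) % N = j % N := by rw [h4, Int.add_mul_emod_self_right]
  rw [Int.emod_eq_of_lt (by positivity) (by exact_mod_cast hi),
    Int.emod_eq_of_lt (by positivity) (by exact_mod_cast hj)] at h5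
  exact_mod_cast h5

/-- The nonzero terms have pairwise distinct norms, so the norm of the sum is their maximum. -/
theorem norm_smul_pow_le_norm_sum (a : ℕ → ℚ_[p]) {i : ℕ} (hi : i < N) :
    ‖a i • π ^ i‖ ≤ ‖∑ j ∈ Finset.range N, a j • π ^ j‖ := by
  classical
  by_cases hai : a i = 0
  · simp [hai]
  have hs : ∑ j ∈ Finset.range N with a j ≠ 0, a j • π ^ j =
      ∑ j ∈ Finset.range N, a j • π ^ j := by
    refine Finset.sum_filter_of_ne fun j _ hj h0 => hj ?_
    rw [h0, zero_smul]
  have h := IsUltrametricDist.nnnorm_sum_eq_sup_of_pairwise_ne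
    (s := {j ∈ Finset.range N | a j ≠ 0}) (f := fun j => a j • π ^ j) ?_
  · rw [← hs, ← coe_nnnorm, ← coe_nnnorm, h, NNReal.coe_le_coe]
    exact Finset.le_sup (f := fun j => ‖a j • π ^ j‖₊) (by simp [hi, hai])
  · intro j hj k hk hjk hn
    simp only [Finset.coe_filter, Finset.mem_range, Set.mem_ofPred_eq] at hj hk
    exact hjk (eq_of_norm_smul_pow_eq hπ hj.2 hk.2 hj.1 hk.1 (congrArg NNReal.toReal hn))

theorem eq_zero_of_aeval_eq_zero {r : Polynomial ℚ_[p]} (hr : r.degree < N)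
    (h0 : Polynomial.aeval π r = 0) : r = 0 := by
  by_contra hr0
  have hlt : r.natDegree < N := (Polynomial.natDegree_lt_iff_degree_lt hr0).mpr hr
  have h := norm_smul_pow_le_norm_sum hπ r.coeff hlt
  rw [← Polynomial.aeval_eq_sum_range' hlt, h0, norm_zero, norm_le_zero_iff, smul_eq_zero] at h
  rcases h with h | h
  · exact hr0 (Polynomial.leadingCoeff_eq_zero.mp h)
  · exact (norm_pos_of_pow_eq hπ (ne_zero_of_pow_eq hπ)).ne'
      (norm_eq_zero.mpr (eq_zero_of_pow_eq_zero h))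

/-- No nonzero polynomial of degree below `N` kills `π`; this takes the place of an Eisenstein
irreducibility argument. -/
theorem minpoly_eq_of_natDegree_eq {Q : Polynomial ℤ_[p]} (hQ : Q.Monic) (hdeg : Q.natDegree = N)
    (h0 : Polynomial.aeval π Q = 0) : Q.map (algebraMap ℤ_[p] ℚ_[p]) = minpoly ℚ_[p] π := by
  refine minpoly.unique' _ _ (hQ.map _) (by rwa [Polynomial.aeval_map_algebraMap]) fun r hr => ?_
  rw [or_iff_not_imp_right, not_not]
  refine eq_zero_of_aeval_eq_zero hπ ?_
  rwa [hQ.degree_map, Polynomial.degree_eq_natDegree hQ.ne_zero, hdeg] at hr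

/-- The integers of a totally ramified extension are generated by a uniformizer. -/
theorem exists_aeval_eq_of_norm_le_one (hdeg : (minpoly ℚ_[p] π).natDegree = N) {x : PadicAlgCl p}
    (hx : x ∈ IntermediateField.adjoin ℚ_[p] {π}) (hx1 : ‖x‖ ≤ 1) :
    ∃ r : Polynomial ℤ_[p], Polynomial.aeval π r = x := by
  have hint : IsIntegral ℚ_[p] π := Algebra.IsIntegral.isIntegral π
  obtain ⟨r₀, hr₀⟩ : ∃ r : Polynomial ℚ_[p], Polynomial.aeval π r = x := by
    rw [← IntermediateField.mem_toSubalgebra,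
      IntermediateField.adjoin_simple_toSubalgebra_of_isAlgebraic hint.isAlgebraic,
      Algebra.adjoin_singleton_eq_range_aeval] at hx
    exact hx
  let r := r₀ %ₘ minpoly ℚ_[p] π
  have hrx : Polynomial.aeval π r = x := by
    rw [← hr₀]
    exact Polynomial.aeval_modByMonic_eq_self_of_root (minpoly.aeval _ _)
  have hlt : r.natDegree < N :=
    hdeg ▸ Polynomial.natDegree_modByMonic_lt _ (minpoly.monic hint) (minpoly.ne_one _ _)
  rw [Polynomial.aeval_eq_sum_range' hlt] at hrx
  have hπ1 := norm_lt_one_of_pow_eq hπ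
  have hπ0 := norm_pos_of_pow_eq hπ (ne_zero_of_pow_eq hπ)
  -- Each coefficient times `‖π‖ ^ i > 1/p` has norm at most `1`, so the coefficient has norm below
  -- `p`, hence at most `1` by discreteness.
  have hc : ∀ i < N, ‖r.coeff i‖ ≤ 1 := by
    intro i hi
    have h1 := norm_smul_pow_le_norm_sum hπ r.coeff hi
    rw [hrx, norm_smul, norm_pow] at h1
    have h2 : (p : ℝ)⁻¹ < ‖π‖ ^ i := hπ ▸ pow_lt_pow_right_of_lt_one₀ hπ0 hπ1 hi
    have h3 : ‖r.coeff i‖ < p := by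
      have hp0 : (0 : ℝ) < p := Nat.cast_pos.mpr (Fact.out : p.Prime).pos
      by_contra! h
      have h4 : (p : ℝ) * (p : ℝ)⁻¹ < ‖r.coeff i‖ * ‖π‖ ^ i :=
        mul_lt_mul' h h2 inv_prime_pos.le (hp0.trans_le h)
      rw [mul_inv_cancel₀ hp0.ne'] at h4
      linarith
    have h4 := (Padic.norm_le_pow_iff_norm_lt_pow_add_one (r.coeff i) 0).mpr (by simpa using h3)
    simpa using h4
  refine ⟨∑ i : Fin N, Polynomial.monomial (i : ℕ) (⟨r.coeff i, hc i i.2⟩ : ℤ_[p]), ?_⟩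
  rw [map_sum, ← hrx, Finset.sum_range]
  refine Finset.sum_congr rfl fun i _ => ?_
  exact (Polynomial.aeval_monomial π).trans (Algebra.smul_def _ _).symm

end Uniformizer

theorem norm_aeval_sub_aeval_le {x y : PadicAlgCl p} (hx : ‖x‖ ≤ 1) (hy : ‖y‖ ≤ 1)
    (r : Polynomial ℤ_[p]) : ‖Polynomial.aeval x r - Polynomial.aeval y r‖ ≤ ‖x - y‖ := by
  induction r using Polynomial.induction_on' with
  | add r s hr hs =>
    rw [map_add, map_add, add_sub_add_comm]
    exact (IsUltrametricDist.norm_add_le_max _ _).trans (max_le hr hs)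
  | monomial n a =>
    rw [Polynomial.aeval_monomial, Polynomial.aeval_monomial, ← mul_sub, norm_mul]
    refine (mul_le_of_le_one_left (norm_nonneg _) (norm_algebraMap_le_one a)).trans ?_
    rw [← geom_sum₂_mul, norm_mul]
    refine mul_le_of_le_one_left (norm_nonneg _) ?_
    refine IsUltrametricDist.norm_sum_le_of_forall_le_of_nonneg zero_le_one fun i _ => ?_
    rw [norm_mul, norm_pow, norm_pow]
    exact mul_le_one₀ (pow_le_one₀ (norm_nonneg _) hx) (by positivity)
      (pow_le_one₀ (norm_nonneg _) hy)

theorem norm_aeval_sub_coeff_zero_le {x : PadicAlgCl p} (hx : ‖x‖ ≤ 1) (r : Polynomial ℤ_[p]) :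
    ‖Polynomial.aeval x r - algebraMap ℤ_[p] (PadicAlgCl p) (r.coeff 0)‖ ≤ ‖x‖ := by
  have h := norm_aeval_sub_aeval_le hx (y := 0) (by simp) r
  rwa [sub_zero, ← Polynomial.coeff_zero_eq_aeval_zero'] at h

theorem norm_ev_sub_ev_le {x y : PadicAlgCl p} (hx : ‖x‖ < 1) (hy : ‖y‖ < 1) (g : ℤ_[p]⟦X⟧) :
    ‖ev x g - ev y g‖ ≤ ‖x - y‖ := by
  have h := (hasValueAt_ev hx g).sub (hasValueAt_ev hy g)
  rw [← h.tsum_eq]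
  refine IsUltrametricDist.norm_tsum_le_of_forall_le_of_nonneg (norm_nonneg _) fun i => ?_
  have h2 := norm_aeval_sub_aeval_le hx.le hy.le (Polynomial.monomial i (coeff i g))
  rwa [Polynomial.aeval_monomial, Polynomial.aeval_monomial] at h2

end CommutingPair

namespace CommutingPair

variable {p : ℕ} [Fact p.Prime]

/-! ### Series of Weierstrass degree `p` with linear coefficient of valuation one -/

/-- `f = x (p A + x^{p-1} B)` with units `A` and `B`. -/
structure IsHeightOne (f A B : ℤ_[p]⟦X⟧) : Prop where
  isUnit_left : IsUnit A
  isUnit_right : IsUnit B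
  eq_mul : f = X * (C (p : ℤ_[p]) * A + X ^ (p - 1) * B)

theorem toZMod_eq_zero_iff_dvd (a : ℤ_[p]) : PadicInt.toZMod a = 0 ↔ (p : ℤ_[p]) ∣ a := by
  rw [← RingHom.mem_ker, PadicInt.ker_toZMod, PadicInt.maximalIdeal_eq_span_p,
    Ideal.mem_span_singleton]

theorem isUnit_iff_not_dvd (a : ℤ_[p]) : IsUnit a ↔ ¬ (p : ℤ_[p]) ∣ a := by
  rw [← PadicInt.norm_lt_one_iff_dvd, PadicInt.isUnit_iff, not_lt]
  exact ⟨fun h => h.ge, fun h => le_antisymm a.2 h⟩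

theorem exists_eq_prime_mul_unit {a : ℤ_[p]} (ha : a.valuation = 1) :
    ∃ b, IsUnit b ∧ a = p * b := by
  have ha0 : a ≠ 0 := by
    rintro rfl
    simp at ha
  refine ⟨PadicInt.unitCoeff ha0, Units.isUnit _, ?_⟩
  conv_lhs => rw [PadicInt.unitCoeff_spec ha0, ha, pow_one]
  ring

theorem exists_isHeightOne {f : ℤ_[p]⟦X⟧} (h0 : coeff 0 f = 0) (hw : wideg f = p)
    (hv : (coeff 1 f).valuation = 1) : ∃ A B, IsHeightOne f A B := by
  obtain ⟨h1, h2⟩ := order_eq_nat.mp hw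
  simp only [coeff_map] at h1 h2
  have hp := (Fact.out : p.Prime).two_le
  have hd : ∀ i, ∃ b : ℤ_[p], i < p → coeff i f = p * b := fun i => by
    by_cases hi : i < p
    · obtain ⟨b, hb⟩ := (toZMod_eq_zero_iff_dvd _).mp (h2 i hi)
      exact ⟨b, fun _ => hb⟩
    · exact ⟨0, fun h => absurd h hi⟩
  choose b hb using hd
  obtain ⟨c, hc, hc1⟩ := exists_eq_prime_mul_unit hv
  have hp0 : (p : ℤ_[p]) ≠ 0 := NeZero.ne _
  -- `A` collects the quotients by `p` of the coefficients of degree `1` to `p - 1`, shifted by the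
  -- factor `X`; `B` collects those of degree `p` and above.
  refine ⟨mk fun i => if i + 1 < p then b (i + 1) else 0, mk fun i => coeff (i + p) f, ?_, ?_, ?_⟩
  · rw [isUnit_iff_constantCoeff, ← coeff_zero_eq_constantCoeff_apply, coeff_mk,
      if_pos (by omega)]
    rwa [mul_left_cancel₀ hp0 ((hb 1 (by omega)).symm.trans hc1)]
  · rw [isUnit_iff_constantCoeff, ← coeff_zero_eq_constantCoeff_apply, coeff_mk, zero_add,
      isUnit_iff_not_dvd, ← toZMod_eq_zero_iff_dvd]
    exact h1
  · ext i
    rcases i with _ | i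
    · rw [h0]
      simp
    · rw [coeff_succ_X_mul, map_add, coeff_C_mul, coeff_mk, coeff_X_pow_mul']
      by_cases hi : i + 1 < p
      · rw [if_pos hi, if_neg (by omega), add_zero, hb _ hi]
      · rw [if_neg hi, if_pos (by omega), mul_zero, zero_add, coeff_mk]
        congr 2
        omega

/-- The roots of `f^{∘ (n+1)}` in the open unit disc which are not roots of `f^{∘ n}`. -/
def Prim (f : ℤ_[p]⟦X⟧) (n : ℕ) : Set (PadicAlgCl p) :=
  {x | ‖x‖ < 1 ∧ ev x (iter f n) ≠ 0 ∧ ev x (iter f (n + 1)) = 0}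

theorem ev_iter_succ {f : ℤ_[p]⟦X⟧} (h0 : coeff 0 f = 0) (n : ℕ) {x : PadicAlgCl p}
    (hx : ‖x‖ < 1) : ev x (iter f (n + 1)) = ev (ev x f) (iter f n) :=
  ev_comp hx _ h0

theorem ev_iter_succ' {f : ℤ_[p]⟦X⟧} (h0 : coeff 0 f = 0) (n : ℕ) {x : PadicAlgCl p}
    (hx : ‖x‖ < 1) : ev x (iter f (n + 1)) = ev (ev x (iter f n)) f := by
  rw [ev_iter h0 _ hx, ev_iter h0 _ hx, Function.iterate_succ_apply']

theorem norm_ev_iter_lt_one {f : ℤ_[p]⟦X⟧} (h0 : coeff 0 f = 0) (n : ℕ) {x : PadicAlgCl p}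
    (hx : ‖x‖ < 1) : ‖ev x (iter f n)‖ < 1 :=
  (norm_ev_le hx (coeff_zero_iter h0 n)).trans_lt hx

theorem ev_mem_prim {f : ℤ_[p]⟦X⟧} (h0 : coeff 0 f = 0) {n : ℕ} {x : PadicAlgCl p}
    (hx : x ∈ Prim f (n + 1)) : ev x f ∈ Prim f n := by
  obtain ⟨h1, h2, h3⟩ := hx
  exact ⟨(norm_ev_le h1 h0).trans_lt h1, ev_iter_succ h0 n h1 ▸ h2, ev_iter_succ h0 _ h1 ▸ h3⟩

theorem galois_mem_prim {f : ℤ_[p]⟦X⟧} (σ : Gal(PadicAlgCl p/ℚ_[p])) {n : ℕ} {x : PadicAlgCl p}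
    (hx : x ∈ Prim f n) : σ x ∈ Prim f n := by
  obtain ⟨h1, h2, h3⟩ := hx
  refine ⟨by rwa [norm_galois], ?_, ?_⟩
  · rwa [← galois_ev σ h1, Ne, map_eq_zero_iff σ σ.injective]
  · rw [← galois_ev σ h1, h3, map_zero]

theorem eq_of_mem_prim {f : ℤ_[p]⟦X⟧} (h0 : coeff 0 f = 0) {m n : ℕ} {x : PadicAlgCl p}
    (hm : x ∈ Prim f m) (hn : x ∈ Prim f n) : m = n := by
  have key : ∀ k j, ev x (iter f k) = 0 → ev x (iter f (k + j)) = 0 := by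
    intro k j hk
    induction j with
    | zero => exact hk
    | succ j ih => rw [← add_assoc, ev_iter_succ' h0 _ hm.1, ih, ev_at_zero, h0, map_zero]
  by_contra hne
  rcases lt_or_gt_of_ne hne with h | h
  · obtain ⟨j, rfl⟩ := Nat.exists_eq_add_of_lt h
    exact hn.2.1 (by simpa only [add_right_comm] using key (m + 1) j hm.2.2)
  · obtain ⟨j, rfl⟩ := Nat.exists_eq_add_of_lt h
    exact hm.2.1 (by simpa only [add_right_comm] using key (n + 1) j hn.2.2)

/-! ### Sizes of the roots, and the iterates of `f` modulo `p`. -/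

namespace IsHeightOne

variable {f A B : ℤ_[p]⟦X⟧} (hf : IsHeightOne f A B)

include hf

theorem coeff_zero : coeff 0 f = 0 := by
  rw [hf.eq_mul]
  simp

theorem ev_eq {x : PadicAlgCl p} (hx : ‖x‖ < 1) :
    ev x f = x * (p * ev x A + x ^ (p - 1) * ev x B) := by
  conv_lhs => rw [hf.eq_mul]
  rw [ev_mul hx, ev_X, ev_add hx, ev_mul hx, ev_mul hx, ev_pow hx, ev_X, ev_C, map_natCast]

theorem norm_of_ev_eq_zero {x : PadicAlgCl p} (hx : ‖x‖ < 1) (hx0 : x ≠ 0) (h : ev x f = 0) :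
    ‖x‖ ^ (p - 1) = (p : ℝ)⁻¹ := by
  rw [hf.ev_eq hx, mul_eq_zero, or_iff_right hx0, add_eq_zero_iff_eq_neg] at h
  have h' := congrArg norm h
  rwa [norm_neg, norm_mul, norm_mul, norm_ev_eq_one hx hf.isUnit_left,
    norm_ev_eq_one hx hf.isUnit_right, norm_pow, mul_one, mul_one, norm_natCast_prime,
    eq_comm] at h'

/-- When `f(x)` is not too small, the term `x^p B(x)` strictly dominates `p x A(x)`: otherwise
`‖f(x)‖` would be less than `1/p`, contradicting the lower bound. -/
theorem norm_of_ev_eq {x : PadicAlgCl p} (hx : ‖x‖ < 1)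
    (h : (p : ℝ)⁻¹ ≤ ‖ev x f‖ ^ (p - 1)) : ‖x‖ ^ p = ‖ev x f‖ := by
  have hp := (Fact.out : p.Prime).two_le
  have hA : ‖(p : PadicAlgCl p) * ev x A‖ = (p : ℝ)⁻¹ := by
    rw [norm_mul, norm_ev_eq_one hx hf.isUnit_left, norm_natCast_prime, mul_one]
  have hB : ‖x ^ (p - 1) * ev x B‖ = ‖x‖ ^ (p - 1) := by
    rw [norm_mul, norm_ev_eq_one hx hf.isUnit_right, norm_pow, mul_one]
  have hlt : (p : ℝ)⁻¹ < ‖x‖ ^ (p - 1) := by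
    by_contra! hle
    have h1 : ‖ev x f‖ ≤ ‖x‖ * (p : ℝ)⁻¹ := by
      rw [hf.ev_eq hx, norm_mul]
      refine mul_le_mul_of_nonneg_left ?_ (norm_nonneg _)
      exact (IsUltrametricDist.norm_add_le_max _ _).trans (by rw [hA, hB, max_eq_left hle])
    have h2 : ‖ev x f‖ < (p : ℝ)⁻¹ := h1.trans_lt (mul_lt_of_lt_one_left inv_prime_pos hx)
    have h3 : ‖ev x f‖ ^ (p - 1) ≤ ‖ev x f‖ :=
      pow_le_of_le_one (norm_nonneg _) (norm_ev_le_one hx f) (by omega)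
    linarith
  rw [hf.ev_eq hx, norm_mul,
    IsUltrametricDist.norm_add_eq_max_of_norm_ne_norm (by rw [hA, hB]; exact hlt.ne), hA, hB,
    max_eq_right hlt.le, ← pow_succ', Nat.sub_add_cancel (by omega)]

theorem norm_pow_of_mem_prim {n : ℕ} {x : PadicAlgCl p} (hx : x ∈ Prim f n) :
    ‖x‖ ^ (p ^ n * (p - 1)) = (p : ℝ)⁻¹ := by
  induction n generalizing x with
  | zero =>
    obtain ⟨h1, h2, h3⟩ := hx
    rw [ev_iter_succ hf.coeff_zero _ h1] at h3
    simp only [iter, ev_X] at h2 h3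
    rw [pow_zero, one_mul, hf.norm_of_ev_eq_zero h1 h2 h3]
  | succ n ih =>
    have hy := ih (ev_mem_prim hf.coeff_zero hx)
    have h1 : ‖x‖ ^ p = ‖ev x f‖ := by
      refine hf.norm_of_ev_eq hx.1 ?_
      rw [← hy, mul_comm, pow_mul]
      exact pow_le_of_le_one (by positivity)
        (pow_le_one₀ (norm_nonneg _) (norm_ev_le_one hx.1 f))
        (pow_ne_zero _ (Fact.out : p.Prime).ne_zero)
    rw [pow_succ', mul_assoc, pow_mul, h1, hy]

theorem exists_iter_congr (n : ℕ) :
    ∃ b, IsUnit b ∧ C (p : ℤ_[p]) ∣ iter f n - X ^ p ^ n * b := by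
  have hs : HasSubst f := HasSubst.of_constantCoeff_zero' (by simpa using hf.coeff_zero)
  have hp := (Fact.out : p.Prime).two_le
  induction n with
  | zero => exact ⟨1, isUnit_one, by simp [iter]⟩
  | succ n ih =>
    obtain ⟨b, hb, c, hc⟩ := ih
    let φ := substAlgHom (R := ℤ_[p]) hs
    have hφ : ∀ g, φ g = comp g f := fun g => by simp [φ, comp, coe_substAlgHom]
    have h1 : iter f (n + 1) = C (p : ℤ_[p]) * φ c + f ^ p ^ n * φ b := by
      have : φ X = f := by rw [hφ, comp, subst_X hs]
      rw [iter, ← hφ, sub_eq_iff_eq_add.mp hc, map_add, map_mul, map_mul, map_pow, this]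
      congr 2
      rw [hφ, comp, subst_C]
      rfl
    have h2 : C (p : ℤ_[p]) ∣ f ^ p ^ n - (X ^ p * B) ^ p ^ n := by
      refine dvd_trans ⟨X * A, ?_⟩ (sub_dvd_pow_sub_pow _ _ _)
      have hX : (X : ℤ_[p]⟦X⟧) ^ p = X * X ^ (p - 1) := by
        rw [← pow_succ', Nat.sub_add_cancel (by omega)]
      conv_lhs => rw [hf.eq_mul, hX]
      ring
    refine ⟨B ^ p ^ n * φ b, (hf.isUnit_right.pow _).mul (hb.map φ), ?_⟩
    have h3 : iter f (n + 1) - X ^ p ^ (n + 1) * (B ^ p ^ n * φ b) =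
        C (p : ℤ_[p]) * φ c + (f ^ p ^ n - (X ^ p * B) ^ p ^ n) * φ b := by
      rw [h1, mul_pow, ← pow_mul, pow_succ' p n]
      ring
    rw [h3]
    exact dvd_add (dvd_mul_right _ _) (h2.mul_right _)

end IsHeightOne

/-! ### Weierstrass preparation and the polynomial of each level. -/

theorem order_map_residue {g b : ℤ_[p]⟦X⟧} {N : ℕ} (hb : IsUnit b)
    (hg : C (p : ℤ_[p]) ∣ g - X ^ N * b) : (g.map (IsLocalRing.residue ℤ_[p])).order = N := by
  have hmap : g.map (IsLocalRing.residue ℤ_[p]) = X ^ N * b.map (IsLocalRing.residue ℤ_[p]) := by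
    obtain ⟨c, hc⟩ := hg
    have hp : IsLocalRing.residue ℤ_[p] (p : ℤ_[p]) = 0 := by
      rw [IsLocalRing.residue_eq_zero_iff, PadicInt.maximalIdeal_eq_span_p]
      exact Ideal.mem_span_singleton_self _
    have h := congrArg (PowerSeries.map (IsLocalRing.residue ℤ_[p])) hc
    rw [map_sub, map_mul, map_mul, map_C, hp, map_zero, zero_mul, sub_eq_zero, map_pow, map_X] at h
    exact h
  rw [hmap, order_mul, order_X_pow, order_zero_of_unit (hb.map _), add_zero]

theorem exists_weierstrass {g b : ℤ_[p]⟦X⟧} {N : ℕ} (hb : IsUnit b)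
    (hg : C (p : ℤ_[p]) ∣ g - X ^ N * b) :
    ∃ (Q : Polynomial ℤ_[p]) (h : ℤ_[p]⟦X⟧), Q.Monic ∧ Q.natDegree = N ∧
      (∀ i < N, (p : ℤ_[p]) ∣ Q.coeff i) ∧ IsUnit h ∧ g = Q * h ∧
      ∀ s : ℤ_[p]⟦X⟧, ∃ (q : ℤ_[p]⟦X⟧) (r : Polynomial ℤ_[p]), r.degree < N ∧ s = Q * q + r := by
  have hord := order_map_residue hb hg
  have hne : g.map (IsLocalRing.residue ℤ_[p]) ≠ 0 := by
    intro h
    rw [h, order_zero] at hord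
    exact ENat.natCast_ne_top N hord.symm
  obtain ⟨Q, h, H⟩ := exists_isWeierstrassFactorization hne
  have hdeg : Q.natDegree = N := by rw [H.natDegree_eq_toNat_order_map, hord, ENat.toNat_natCast]
  refine ⟨Q, h, H.isDistinguishedAt.monic, hdeg, fun i hi => ?_, H.isUnit, H.eq_mul, fun s => ?_⟩
  · have := H.isDistinguishedAt.mem (hdeg ▸ hi)
    rwa [PadicInt.maximalIdeal_eq_span_p, Ideal.mem_span_singleton] at this
  · obtain ⟨q, r, hqr⟩ := exists_isWeierstrassDivision s hne
    refine ⟨h * q, r, ?_, ?_⟩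
    · have hlt := hqr.degree_lt
      change r.degree < ((g.map (IsLocalRing.residue ℤ_[p])).order.toNat : WithBot ℕ) at hlt
      rwa [hord, ENat.toNat_natCast] at hlt
    · rw [← mul_assoc, ← H.eq_mul]
      exact hqr.eq_mul_add

theorem norm_lt_one_of_root {Q : Polynomial ℤ_[p]} (hm : Q.Monic)
    (hd : ∀ i < Q.natDegree, (p : ℤ_[p]) ∣ Q.coeff i) {x : PadicAlgCl p}
    (hx : Polynomial.aeval x Q = 0) : ‖x‖ < 1 := by
  by_contra! h1
  rw [Polynomial.aeval_eq_sum_range, Finset.sum_range_succ, hm.coeff_natDegree, one_smul,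
    add_comm, add_eq_zero_iff_eq_neg] at hx
  have h2 : ‖x‖ ^ Q.natDegree ≤ (p : ℝ)⁻¹ * ‖x‖ ^ Q.natDegree := by
    conv_lhs => rw [← norm_pow, hx, norm_neg]
    refine IsUltrametricDist.norm_sum_le_of_forall_le_of_nonneg
      (mul_nonneg inv_prime_pos.le (by positivity)) fun i hi => ?_
    rw [Finset.mem_range] at hi
    rw [Algebra.smul_def, norm_mul, norm_pow]
    refine mul_le_mul ?_ (pow_le_pow_right₀ h1 hi.le) (by positivity) inv_prime_pos.le
    obtain ⟨c, hc⟩ := hd i hi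
    rw [hc, map_mul, norm_mul, map_natCast, norm_natCast_prime]
    exact mul_le_of_le_one_right inv_prime_pos.le (norm_algebraMap_le_one c)
  have h3 : 0 < ‖x‖ ^ Q.natDegree := by positivity
  nlinarith [inv_prime_lt_one (p := p)]

/-- Write `f = x g`. Then `Q` is the distinguished factor of `g ∘ f^{∘n}`; it detects exactly the
new roots because `g(0) = p A(0) ≠ 0`. The division clause lets series vanishing on a level be
divided by `Q`. -/
theorem IsHeightOne.exists_poly {f A B : ℤ_[p]⟦X⟧} (hf : IsHeightOne f A B) (n : ℕ) :
    ∃ Q : Polynomial ℤ_[p], Q.Monic ∧ Q.natDegree = p ^ n * (p - 1) ∧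
      (∀ i < p ^ n * (p - 1), (p : ℤ_[p]) ∣ Q.coeff i) ∧
      (∀ x, Polynomial.aeval x Q = 0 ↔ x ∈ Prim f n) ∧
      ∀ s : ℤ_[p]⟦X⟧, ∃ (q : ℤ_[p]⟦X⟧) (r : Polynomial ℤ_[p]),
        r.degree < (p ^ n * (p - 1) : ℕ) ∧ s = Q * q + r := by
  have hF0 := coeff_zero_iter hf.coeff_zero n
  have hs : HasSubst (iter f n) := HasSubst.of_constantCoeff_zero' (by simpa using hF0)
  obtain ⟨b, hb, hbd⟩ := hf.exists_iter_congr n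
  let φ := substAlgHom (R := ℤ_[p]) hs
  have hφ : ∀ g, φ g = comp g (iter f n) := fun g => by simp [φ, comp, coe_substAlgHom]
  have hX : φ X = iter f n := by rw [hφ, comp, subst_X hs]
  have hC : φ (C (p : ℤ_[p])) = C (p : ℤ_[p]) := by
    rw [hφ, comp, subst_C]
    rfl
  let g := C (p : ℤ_[p]) * A + X ^ (p - 1) * B
  have hd : C (p : ℤ_[p]) ∣ φ g - X ^ (p ^ n * (p - 1)) * (b ^ (p - 1) * φ B) := by
    have h1 : φ g - X ^ (p ^ n * (p - 1)) * (b ^ (p - 1) * φ B) = C (p : ℤ_[p]) * φ A +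
        (iter f n ^ (p - 1) - (X ^ p ^ n * b) ^ (p - 1)) * φ B := by
      simp only [g, map_add, map_mul, map_pow, hX, hC, mul_pow, pow_mul]
      ring
    rw [h1]
    exact dvd_add (dvd_mul_right _ _) ((hbd.trans (sub_dvd_pow_sub_pow _ _ _)).mul_right _)
  obtain ⟨Q, h, hm, hdeg, hdvd, hu, heq, hdiv⟩ :=
    exists_weierstrass ((hb.pow _).mul (hf.isUnit_right.map φ)) hd
  refine ⟨Q, hm, hdeg, hdvd, fun x => ?_, hdiv⟩
  have key : ‖x‖ < 1 → (Polynomial.aeval x Q = 0 ↔ ev (ev x (iter f n)) g = 0) := fun hx => by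
    rw [← ev_comp hx _ hF0, ← hφ, heq, ev_mul hx, ev_coe, mul_eq_zero, or_iff_left]
    intro h0
    have := norm_ev_eq_one hx hu
    simp [h0] at this
  have hfg : ∀ y : PadicAlgCl p, ‖y‖ < 1 → ev y f = y * ev y g := fun y hy => by
    conv_lhs => rw [hf.eq_mul]
    rw [ev_mul hy, ev_X]
  constructor
  · intro hx
    have hx1 := norm_lt_one_of_root hm (hdeg ▸ hdvd) hx
    have h2 := (key hx1).mp hx
    have hy1 := norm_ev_iter_lt_one hf.coeff_zero n hx1
    refine ⟨hx1, fun h0 => ?_, ?_⟩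
    · rw [h0, ev_at_zero] at h2
      have hA : IsUnit (constantCoeff A) := isUnit_iff_constantCoeff.mp hf.isUnit_left
      have hp := (Fact.out : p.Prime).two_le
      have h3 : coeff 0 g = p * constantCoeff A := by
        simp [g, show p - 1 ≠ 0 by omega]
      rw [h3, map_mul, mul_eq_zero, map_natCast] at h2
      rcases h2 with h2 | h2
      · have := norm_natCast_prime (p := p)
        rw [h2, norm_zero] at this
        exact inv_prime_pos.ne this
      · exact (hA.map (algebraMap ℤ_[p] (PadicAlgCl p))).ne_zero h2
    · rw [ev_iter_succ' hf.coeff_zero n hx1, hfg _ hy1, h2, mul_zero]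
  · rintro ⟨hx1, h2, h3⟩
    rw [ev_iter_succ' hf.coeff_zero n hx1, hfg _ (norm_ev_iter_lt_one hf.coeff_zero n hx1),
      mul_eq_zero, or_iff_right h2] at h3
    exact (key hx1).mpr h3

end CommutingPair

namespace CommutingPair

variable {p : ℕ} [Fact p.Prime]

theorem coeff_zero_mul_eq (g h : ℤ_[p]⟦X⟧) : coeff 0 (g * h) = coeff 0 g * coeff 0 h := by
  simp

/-! ### Conjugacy of the roots -/

namespace IsHeightOne

variable {f A B : ℤ_[p]⟦X⟧} (hf : IsHeightOne f A B)

include hf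

theorem natDegree_minpoly {n : ℕ} {x : PadicAlgCl p} (hx : x ∈ Prim f n) :
    (minpoly ℚ_[p] x).natDegree = p ^ n * (p - 1) := by
  obtain ⟨Q, hm, hdeg, -, hQ, -⟩ := hf.exists_poly n
  rw [← minpoly_eq_of_natDegree_eq (hf.norm_pow_of_mem_prim hx) hm hdeg ((hQ x).mpr hx),
    hm.natDegree_map, hdeg]

theorem finrank_adjoin {n : ℕ} {x : PadicAlgCl p} (hx : x ∈ Prim f n) :
    Module.finrank ℚ_[p] (IntermediateField.adjoin ℚ_[p] {x}) = p ^ n * (p - 1) := by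
  rw [IntermediateField.adjoin.finrank (Algebra.IsIntegral.isIntegral x), hf.natDegree_minpoly hx]

theorem exists_galois_eq {n : ℕ} {x y : PadicAlgCl p} (hx : x ∈ Prim f n) (hy : y ∈ Prim f n) :
    ∃ σ : Gal(PadicAlgCl p/ℚ_[p]), σ x = y := by
  obtain ⟨Q, hm, hdeg, -, hQ, -⟩ := hf.exists_poly n
  rw [← isConjRoot_iff_exists_algEquiv, IsConjRoot,
    ← minpoly_eq_of_natDegree_eq (hf.norm_pow_of_mem_prim hx) hm hdeg ((hQ x).mpr hx),
    ← minpoly_eq_of_natDegree_eq (hf.norm_pow_of_mem_prim hy) hm hdeg ((hQ y).mpr hy)]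

theorem prim_nonempty (n : ℕ) : (Prim f n).Nonempty := by
  obtain ⟨Q, hm, hdeg, -, hQ, -⟩ := hf.exists_poly n
  have hp := (Fact.out : p.Prime).two_le
  have hpos : 0 < p ^ n * (p - 1) := Nat.mul_pos (by positivity) (by omega)
  have hinj : Function.Injective (algebraMap ℤ_[p] (PadicAlgCl p)) := by
    rw [IsScalarTower.algebraMap_eq ℤ_[p] ℚ_[p] (PadicAlgCl p)]
    exact (algebraMap ℚ_[p] (PadicAlgCl p)).injective.comp
      (FaithfulSMul.algebraMap_injective ℤ_[p] ℚ_[p])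
  obtain ⟨x, hx⟩ := IsAlgClosed.exists_aeval_eq_zero_of_injective (PadicAlgCl p) hinj Q
    (by rw [Polynomial.degree_eq_natDegree hm.ne_zero, hdeg]; exact_mod_cast hpos.ne')
  exact ⟨x, (hQ x).mp hx⟩

/-- Any root one level up has an image under `f` on the level of `x`, and a Galois automorphism
carries that image to `x`. -/
theorem exists_consistent_succ {n : ℕ} {x : PadicAlgCl p} (hx : x ∈ Prim f n) :
    ∃ y ∈ Prim f (n + 1), ev y f = x := by
  obtain ⟨z, hz⟩ := hf.prim_nonempty (n + 1)
  obtain ⟨σ, hσ⟩ := hf.exists_galois_eq (ev_mem_prim hf.coeff_zero hz) hx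
  exact ⟨σ z, galois_mem_prim σ hz, by rw [← galois_ev σ hz.1, hσ]⟩

theorem norm_pos_of_mem_prim {n : ℕ} {x : PadicAlgCl p} (hx : x ∈ Prim f n) : 0 < ‖x‖ :=
  norm_pos_of_pow_eq (hf.norm_pow_of_mem_prim hx) (ne_zero_of_pow_eq (hf.norm_pow_of_mem_prim hx))

/-- Distinct nonzero roots of `f` are as far apart as possible. -/
theorem eq_of_mem_prim_zero {x y : PadicAlgCl p} (hx : x ∈ Prim f 0) (hy : y ∈ Prim f 0)
    (h : ‖x - y‖ < ‖y‖) : x = y := by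
  have hp := (Fact.out : p.Prime).two_le
  have hroot : ∀ z ∈ Prim f 0, (p : PadicAlgCl p) * ev z A + z ^ (p - 1) * ev z B = 0 := by
    rintro z ⟨h1, h2, h3⟩
    rw [ev_iter_succ hf.coeff_zero _ h1] at h3
    simp only [iter, ev_X] at h2 h3
    rwa [hf.ev_eq h1, mul_eq_zero, or_iff_right h2] at h3
  have hy0 := hf.norm_pos_of_mem_prim hy
  have hxy := norm_eq_of_norm_sub_lt h
  have hypow := hf.norm_pow_of_mem_prim hy
  rw [pow_zero, one_mul] at hypow
  by_contra hne
  have hd : 0 < ‖x - y‖ := norm_pos_iff.mpr (sub_ne_zero.mpr hne)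
  -- Subtract the two root equations; evaluation of `A` and `B` is 1-Lipschitz, and `‖y‖ ^ (p - 1) =
  -- 1/p`.
  have h1 : ‖(x ^ (p - 1) - y ^ (p - 1)) * ev x B‖ ≤ (p : ℝ)⁻¹ * ‖x - y‖ := by
    have h2 : (x ^ (p - 1) - y ^ (p - 1)) * ev x B =
        -(p * (ev x A - ev y A) + y ^ (p - 1) * (ev x B - ev y B)) := by
      linear_combination hroot x hx - hroot y hy
    rw [h2, norm_neg]
    refine (IsUltrametricDist.norm_add_le_max _ _).trans (max_le ?_ ?_)
    · rw [norm_mul, norm_natCast_prime]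
      exact mul_le_mul_of_nonneg_left (norm_ev_sub_ev_le hx.1 hy.1 A) inv_prime_pos.le
    · rw [norm_mul, norm_pow, hypow]
      exact mul_le_mul_of_nonneg_left (norm_ev_sub_ev_le hx.1 hy.1 B) inv_prime_pos.le
  rw [norm_mul, norm_ev_eq_one hx.1 hf.isUnit_right, mul_one, ← geom_sum₂_mul, norm_mul] at h1
  have h2 := le_of_mul_le_mul_right h1 hd
  -- As `x` is close to `y`, the geometric sum is nearly `(p - 1) y^(p-2)`, of norm `‖y‖ ^ (p - 2) >
  -- 1/p`, against the bound `h2`.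
  have h3 : ‖∑ i ∈ Finset.range (p - 1), x ^ i * y ^ (p - 1 - 1 - i) -
      ((p - 1 : ℕ) : PadicAlgCl p) * y ^ (p - 2)‖ < ‖y‖ ^ (p - 2) := by
    have : ((p - 1 : ℕ) : PadicAlgCl p) * y ^ (p - 2) =
        ∑ i ∈ Finset.range (p - 1), y ^ i * y ^ (p - 1 - 1 - i) := by
      rw [Finset.sum_congr rfl fun i hi => ?_, Finset.sum_const, Finset.card_range, nsmul_eq_mul]
      rw [Finset.mem_range] at hi
      rw [← pow_add]
      congr 1
      omega
    rw [this, ← Finset.sum_sub_distrib]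
    obtain ⟨i, hi, hle⟩ := IsUltrametricDist.exists_norm_finsetSum_le_of_nonempty
      (t := Finset.range (p - 1)) ⟨0, by simp; omega⟩
      fun i => x ^ i * y ^ (p - 1 - 1 - i) - y ^ i * y ^ (p - 1 - 1 - i)
    refine hle.trans_lt ?_
    rw [Finset.mem_range] at hi
    rw [← sub_mul, norm_mul, norm_pow]
    have h4 : ‖x ^ i - y ^ i‖ < ‖y‖ ^ i := by
      rcases Nat.eq_zero_or_pos i with rfl | hi0
      · simp
      rw [← geom_sum₂_mul, norm_mul]
      have h5 : ‖∑ j ∈ Finset.range i, x ^ j * y ^ (i - 1 - j)‖ ≤ ‖y‖ ^ (i - 1) := by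
        refine IsUltrametricDist.norm_sum_le_of_forall_le_of_nonneg (by positivity) fun j hj => ?_
        rw [Finset.mem_range] at hj
        rw [norm_mul, norm_pow, norm_pow, hxy, ← pow_add]
        exact (congrArg (‖y‖ ^ ·) (by omega)).le
      calc _ ≤ ‖y‖ ^ (i - 1) * ‖x - y‖ := mul_le_mul_of_nonneg_right h5 (norm_nonneg _)
        _ < ‖y‖ ^ (i - 1) * ‖y‖ := mul_lt_mul_of_pos_left h (by positivity)
        _ = ‖y‖ ^ i := by rw [← pow_succ, Nat.sub_add_cancel hi0]
    calc _ < ‖y‖ ^ i * ‖y‖ ^ (p - 1 - 1 - i) := mul_lt_mul_of_pos_right h4 (by positivity)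
      _ = ‖y‖ ^ (p - 2) := by
        rw [← pow_add]
        congr 1
        omega
  have h4 : ‖((p - 1 : ℕ) : PadicAlgCl p) * y ^ (p - 2)‖ = ‖y‖ ^ (p - 2) := by
    rw [norm_mul, norm_pow, ← map_natCast (algebraMap ℤ_[p] (PadicAlgCl p)),
      norm_algebraMap_padicInt, PadicInt.isUnit_iff.mp, one_mul]
    rw [isUnit_iff_not_dvd, ← toZMod_eq_zero_iff_dvd, map_natCast, ZMod.natCast_eq_zero_iff]
    exact Nat.not_dvd_of_pos_of_lt (by omega) (by omega)
  rw [← h4] at h3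
  rw [norm_eq_of_norm_sub_lt h3, h4, ← hypow] at h2
  exact h2.not_gt (pow_lt_pow_right_of_lt_one₀ hy0 hy.1 (by omega))

/-- A series vanishing on the first `m` levels of nonzero roots has constant coefficient divisible
by `p^m`. -/
theorem pow_dvd_coeff_zero (m : ℕ) (g : ℤ_[p]⟦X⟧) (hg : ∀ k < m, ∀ x ∈ Prim f k, ev x g = 0) :
    (p : ℤ_[p]) ^ m ∣ coeff 0 g := by
  induction m generalizing g with
  | zero => simp
  | succ m ih =>
    obtain ⟨Q, hm, hdeg, hdvd, hQ, hdiv⟩ := hf.exists_poly m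
    obtain ⟨q, r, hr, rfl⟩ := hdiv g
    obtain ⟨x, hx⟩ := hf.prim_nonempty m
    -- The remainder vanishes at a root of level `m` but has degree smaller than its minimal
    -- polynomial.
    have hr0 : r = 0 := by
      have h0 := hg m (Nat.lt_succ_self m) x hx
      rw [ev_add hx.1, ev_mul hx.1, ev_coe, ev_coe, (hQ x).mpr hx, zero_mul, zero_add] at h0
      have h1 : r.map (algebraMap ℤ_[p] ℚ_[p]) = 0 := by
        refine eq_zero_of_aeval_eq_zero (hf.norm_pow_of_mem_prim hx)
          (Polynomial.degree_map_le.trans_lt hr) ?_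
        rwa [Polynomial.aeval_map_algebraMap]
      exact (Polynomial.map_eq_zero_iff (FaithfulSMul.algebraMap_injective ℤ_[p] ℚ_[p])).mp h1
    -- The levels are disjoint, so `Q` does not vanish on the lower ones and the quotient must.
    have hq : (p : ℤ_[p]) ^ m ∣ coeff 0 q := by
      refine ih q fun k hk y hy => ?_
      have h0 := hg k (hk.trans (Nat.lt_succ_self m)) y hy
      rw [hr0, Polynomial.coe_zero, add_zero, ev_mul hy.1, ev_coe, mul_eq_zero] at h0
      refine h0.resolve_left fun h1 => hk.ne ?_
      exact eq_of_mem_prim hf.coeff_zero hy ((hQ y).mp h1)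
    have hp := (Fact.out : p.Prime).two_le
    rw [hr0, Polynomial.coe_zero, add_zero, coeff_zero_mul_eq, Polynomial.coeff_coe, pow_succ']
    exact mul_dvd_mul (hdvd 0 (Nat.mul_pos (by positivity) (by omega))) hq

end IsHeightOne

/-! ### Series congruent to the identity which commute with `f` -/

theorem coeff_one_comp {g h : ℤ_[p]⟦X⟧} (hg : coeff 0 g = 0) (hh : coeff 0 h = 0) :
    coeff 1 (comp g h) = coeff 1 g * coeff 1 h := by
  have hs : HasSubst h := HasSubst.of_constantCoeff_zero' (by simpa using hh)
  obtain ⟨g', rfl⟩ := X_dvd_iff.mpr (by simpa using hg)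
  obtain ⟨k, hk⟩ := X_dvd_iff.mpr (by simp :
    constantCoeff (g' - C (constantCoeff g')) = 0)
  obtain ⟨h', hh'⟩ := X_dvd_iff.mpr (by simpa using hh : constantCoeff h = 0)
  have h1 : comp (X * g') h = h * (C (constantCoeff g') + h * comp k h) := by
    rw [comp, subst_mul hs, subst_X hs, sub_eq_iff_eq_add'.mp hk, subst_add hs, subst_mul hs,
      subst_X hs, subst_C]
    simp only [map_add, constantCoeff_C, map_mul, constantCoeff_X, zero_mul, add_zero]
    rfl
  rw [h1]
  conv_lhs => rw [hh', mul_assoc]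
  rw [hh', coeff_succ_X_mul, coeff_succ_X_mul, coeff_succ_X_mul]
  simp [mul_comm]

theorem coeff_one_iter {g : ℤ_[p]⟦X⟧} (hg : coeff 0 g = 0) (n : ℕ) :
    coeff 1 (iter g n) = coeff 1 g ^ n := by
  induction n with
  | zero => simp [iter]
  | succ n ih => rw [iter, coeff_one_comp (coeff_zero_iter hg n) hg, ih, pow_succ]

theorem norm_ev_sub_self_lt {v : ℤ_[p]⟦X⟧} (h0 : coeff 0 v = 0) (h1 : (p : ℤ_[p]) ∣ coeff 1 v - 1)
    {x : PadicAlgCl p} (hx : ‖x‖ < 1) (hx0 : x ≠ 0) : ‖ev x v - x‖ < ‖x‖ := by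
  obtain ⟨w, hw⟩ := X_dvd_iff.mpr (by simpa using h0 : constantCoeff (v - X) = 0)
  have hw0 : coeff 0 w = coeff 1 v - 1 := by
    rw [← coeff_succ_X_mul, ← hw]
    simp
  obtain ⟨w', hw'⟩ := X_dvd_iff.mpr (by simp : constantCoeff (w - C (coeff 0 w)) = 0)
  have h2 : ‖ev x w‖ < 1 := by
    rw [sub_eq_iff_eq_add'.mp hw', ev_add hx, ev_mul hx, ev_X, ev_C]
    refine norm_add_lt ?_ ?_
    · rwa [norm_algebraMap_padicInt, PadicInt.norm_lt_one_iff_dvd, hw0]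
    · rw [norm_mul]
      exact (mul_le_of_le_one_right (norm_nonneg _) (norm_ev_le_one hx w')).trans_lt hx
  have h3 : ev x v - x = x * ev x w := by
    have h4 := congrArg (ev x) hw
    rwa [ev_sub hx, ev_mul hx, ev_X] at h4
  rw [h3, norm_mul]
  exact mul_lt_of_lt_one_right (norm_pos_iff.mpr hx0) h2

/-- `u(x) ≡ x` and `u` commutes with `f`, as functions on the open unit disc. -/
structure IsUnitCommuting (f u : ℤ_[p]⟦X⟧) : Prop where
  coeff_zero : coeff 0 u = 0
  dvd_sub_one : (p : ℤ_[p]) ∣ coeff 1 u - 1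
  comm : ∀ x : PadicAlgCl p, ‖x‖ < 1 → ev (ev x f) u = ev (ev x u) f

namespace IsUnitCommuting

variable {f u : ℤ_[p]⟦X⟧} (hu : IsUnitCommuting f u)

include hu

theorem iter_right (hf0 : coeff 0 f = 0) (k : ℕ) : IsUnitCommuting f (iter u k) where
  coeff_zero := coeff_zero_iter hu.coeff_zero k
  dvd_sub_one := by
    rw [coeff_one_iter hu.coeff_zero]
    simpa using hu.dvd_sub_one.trans (sub_dvd_pow_sub_pow _ 1 k)
  comm := by
    induction k with
    | zero => simp [iter]
    | succ k ih =>
      intro x hx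
      have h1 : ‖ev x u‖ < 1 := (norm_ev_le hx hu.coeff_zero).trans_lt hx
      have h2 : ‖ev x f‖ < 1 := (norm_ev_le hx hf0).trans_lt hx
      rw [ev_iter_succ hu.coeff_zero _ h2, hu.comm x hx, ih _ h1, ev_iter_succ hu.coeff_zero _ hx]

theorem comm_iter_left (hf0 : coeff 0 f = 0) (n : ℕ) {x : PadicAlgCl p} (hx : ‖x‖ < 1) :
    ev (ev x (iter f n)) u = ev (ev x u) (iter f n) := by
  induction n generalizing x with
  | zero => simp [iter]
  | succ n ih =>
    have h1 : ‖ev x u‖ < 1 := (norm_ev_le hx hu.coeff_zero).trans_lt hx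
    have h2 : ‖ev x f‖ < 1 := (norm_ev_le hx hf0).trans_lt hx
    rw [ev_iter_succ hf0 _ hx, ih h2, hu.comm x hx, ev_iter_succ hf0 _ h1]

theorem ev_mem_prim (hf0 : coeff 0 f = 0) {n : ℕ} {x : PadicAlgCl p} (hx : x ∈ Prim f n) :
    ev x u ∈ Prim f n := by
  obtain ⟨h1, h2, h3⟩ := hx
  refine ⟨(norm_ev_le h1 hu.coeff_zero).trans_lt h1, ?_, ?_⟩
  · rw [← hu.comm_iter_left hf0 n h1]
    have h4 := norm_eq_of_norm_sub_lt (norm_ev_sub_self_lt hu.coeff_zero hu.dvd_sub_one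
      (norm_ev_iter_lt_one hf0 n h1) h2)
    rw [← norm_ne_zero_iff, h4]
    exact norm_ne_zero_iff.mpr h2
  · rw [← hu.comm_iter_left hf0 _ h1, h3, ev_at_zero, hu.coeff_zero, map_zero]

variable {A B : ℤ_[p]⟦X⟧} (hf : IsHeightOne f A B)

include hf

/-- `u(x)` is again a nonzero root of `f`, at distance less than `‖x‖` from `x`. -/
theorem ev_eq_self {x : PadicAlgCl p} (hx : x ∈ Prim f 0) : ev x u = x :=
  hf.eq_of_mem_prim_zero (hu.ev_mem_prim hf.coeff_zero hx) hx
    (norm_ev_sub_self_lt hu.coeff_zero hu.dvd_sub_one hx.1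
      (norm_pos_iff.mp (hf.norm_pos_of_mem_prim hx)))

/-- Being fixed by `u` passes to Galois conjugates, hence to the whole level, and to images under
`f`, hence to lower levels. -/
theorem ev_eq_self_of_le {m n : ℕ} (hmn : m ≤ n) {x y : PadicAlgCl p} (hx : x ∈ Prim f n)
    (hy : y ∈ Prim f m) (h : ev x u = x) : ev y u = y := by
  induction n generalizing x with
  | zero =>
    obtain rfl := Nat.le_zero.mp hmn
    exact hu.ev_eq_self hf hy
  | succ n ih =>
    rcases hmn.eq_or_lt with rfl | hlt
    · obtain ⟨σ, rfl⟩ := hf.exists_galois_eq hx hy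
      rw [← galois_ev σ hx.1, h]
    · exact ih (Nat.lt_succ_iff.mp hlt) (CommutingPair.ev_mem_prim hf.coeff_zero hx)
        (by rw [hu.comm x hx.1, h])

/-- The series `(u - X)/X` has constant coefficient `u'(0) - 1` and vanishes on levels `0, …, n`, so
`pow_dvd_coeff_zero` applies. -/
theorem pow_dvd_coeff_one_sub_one {n : ℕ} {x : PadicAlgCl p} (hx : x ∈ Prim f n)
    (h : ev x u = x) : (p : ℤ_[p]) ^ (n + 1) ∣ coeff 1 u - 1 := by
  obtain ⟨w, hw⟩ := X_dvd_iff.mpr (by simpa using hu.coeff_zero : constantCoeff (u - X) = 0)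
  have hw0 : coeff 0 w = coeff 1 u - 1 := by
    rw [← coeff_succ_X_mul, ← hw]
    simp
  rw [← hw0]
  refine hf.pow_dvd_coeff_zero (n + 1) w fun k hk y hy => ?_
  have h1 := hu.ev_eq_self_of_le hf (Nat.lt_succ_iff.mp hk) hx hy h
  have h2 : ev y (u - X) = 0 := by rw [ev_sub hy.1, h1, ev_X, sub_self]
  rw [hw, ev_mul hy.1, ev_X, mul_eq_zero] at h2
  exact h2.resolve_left (norm_pos_iff.mp (hf.norm_pos_of_mem_prim hy))

/-- If `u'(0) - 1` is a uniformizer, then `|u(x) - x| = |x|^p` for roots `x` of level at least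
two. -/
theorem norm_ev_sub_self {b : ℤ_[p]} (hb : IsUnit b) (h1 : coeff 1 u - 1 = p * b) {n : ℕ}
    {x : PadicAlgCl p} (hx : x ∈ Prim f (n + 1)) : ‖ev x u - x‖ = ‖x‖ ^ p := by
  obtain ⟨Q, hm, hdeg, hdvd, hQ, hdiv⟩ := hf.exists_poly 0
  have hp := (Fact.out : p.Prime).two_le
  rw [pow_zero, one_mul] at hdeg hdvd hdiv
  obtain ⟨w, hw⟩ := X_dvd_iff.mpr (by simpa using hu.coeff_zero : constantCoeff (u - X) = 0)
  have hw0 : coeff 0 w = coeff 1 u - 1 := by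
    rw [← coeff_succ_X_mul, ← hw]
    simp
  obtain ⟨q, r, hr, hqr⟩ := hdiv w
  obtain ⟨y, hy⟩ := hf.prim_nonempty 0
  have hr0 : r = 0 := by
    have h0 : ev y (u - X) = 0 := by rw [ev_sub hy.1, hu.ev_eq_self hf hy, ev_X, sub_self]
    rw [hw, ev_mul hy.1, ev_X, mul_eq_zero] at h0
    replace h0 := h0.resolve_left (norm_pos_iff.mp (hf.norm_pos_of_mem_prim hy))
    rw [hqr, ev_add hy.1, ev_mul hy.1, ev_coe, ev_coe, (hQ y).mpr hy, zero_mul, zero_add] at h0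
    have h1 : r.map (algebraMap ℤ_[p] ℚ_[p]) = 0 := by
      refine eq_zero_of_aeval_eq_zero (hf.norm_pow_of_mem_prim hy)
        (Polynomial.degree_map_le.trans_lt (by simpa using hr)) ?_
      rwa [Polynomial.aeval_map_algebraMap]
    exact (Polynomial.map_eq_zero_iff (FaithfulSMul.algebraMap_injective ℤ_[p] ℚ_[p])).mp h1
  rw [hr0, Polynomial.coe_zero, add_zero] at hqr
  -- Constant coefficients: `Q(0)` is divisible by `p`, while the product `Q(0) q(0) = u'(0) - 1` is
  -- `p` times a unit.
  have hq : IsUnit q := by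
    obtain ⟨c, hc⟩ := hdvd 0 (by omega)
    rw [hqr, coeff_zero_mul_eq, Polynomial.coeff_coe, hc, h1, mul_assoc] at hw0
    have hp0 : (p : ℤ_[p]) ≠ 0 := NeZero.ne _
    rw [isUnit_iff_constantCoeff, ← coeff_zero_eq_constantCoeff_apply]
    exact isUnit_of_mul_isUnit_right (mul_left_cancel₀ hp0 hw0 ▸ hb)
  have hx0 := hf.norm_pos_of_mem_prim hx
  -- Since `x` lies above level `0`, the leading term of `Q(x)` dominates all others, whose
  -- coefficients are divisible by `p`.
  have hlt : (p : ℝ)⁻¹ < ‖x‖ ^ (p - 1) := by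
    rw [← hf.norm_pow_of_mem_prim hx]
    refine pow_lt_pow_right_of_lt_one₀ hx0 hx.1 (lt_mul_of_one_lt_left (by omega) ?_)
    exact Nat.one_lt_pow (Nat.succ_ne_zero n) (by omega)
  have hQx : ‖Polynomial.aeval x Q‖ = ‖x‖ ^ (p - 1) := by
    rw [← norm_pow]
    refine norm_eq_of_norm_sub_lt ?_
    rw [Polynomial.aeval_eq_sum_range, Finset.sum_range_succ, hm.coeff_natDegree, one_smul, hdeg,
      add_sub_cancel_right, norm_pow]
    refine lt_of_le_of_lt ?_ hlt
    refine IsUltrametricDist.norm_sum_le_of_forall_le_of_nonneg inv_prime_pos.le fun i hi => ?_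
    obtain ⟨c, hc⟩ := hdvd i (Finset.mem_range.mp hi)
    rw [Algebra.smul_def, hc, map_mul, mul_assoc, norm_mul, map_natCast, norm_natCast_prime,
      norm_mul, norm_pow]
    exact mul_le_of_le_one_right inv_prime_pos.le (mul_le_one₀ (norm_algebraMap_le_one c)
      (by positivity) (pow_le_one₀ (norm_nonneg _) hx.1.le))
  have h3 : ev x u - x = x * (Polynomial.aeval x Q * ev x q) := by
    rw [← ev_coe, ← ev_mul hx.1, ← hqr]
    nth_rw 3 [← ev_X x]
    rw [← ev_mul hx.1, ← hw, ev_sub hx.1, ev_X]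
  rw [h3, norm_mul, norm_mul, hQx, norm_ev_eq_one hx.1 hq, mul_one, ← pow_succ',
    Nat.sub_add_cancel (by omega)]

end IsUnitCommuting

end CommutingPair

namespace CommutingPair

variable {p : ℕ} [Fact p.Prime]

/-! ### The action of the Galois group on the roots -/

theorem exists_pow_sub_one_eq {a b : ℤ_[p]} (hb : IsUnit b) (ha : a - 1 = p * b) {k : ℕ}
    (hk : ¬ p ∣ k) : ∃ c, IsUnit c ∧ a ^ k - 1 = p * c := by
  have hpa : (p : ℤ_[p]) ∣ a - 1 := ⟨b, ha⟩
  have ha1 : ¬ (p : ℤ_[p]) ∣ a := fun h =>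
    PadicInt.prime_p.not_isUnit (isUnit_of_dvd_one (by simpa using dvd_sub h hpa))
  have hk' : ¬ (p : ℤ_[p]) ∣ (k : ℤ_[p]) := by
    rwa [← toZMod_eq_zero_iff_dvd, map_natCast, ZMod.natCast_eq_zero_iff]
  refine ⟨(∑ i ∈ Finset.range k, a ^ i * 1 ^ (k - 1 - i)) * b,
    ((isUnit_iff_not_dvd _).mpr (not_dvd_geom_sum₂ PadicInt.prime_p hpa ha1 hk')).mul hb, ?_⟩
  rw [← one_pow k, ← geom_sum₂_mul, ha, one_pow]
  ring

/-- Lifting the exponent: `v(a^k - 1) = 1 + v(k)` for `k ≠ 0`, where `p` odd is needed. -/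
theorem pow_dvd_of_pow_dvd_pow_sub_one (hp : 2 < p) {a b : ℤ_[p]} (hb : IsUnit b)
    (ha : a - 1 = p * b) {k n : ℕ} (h : (p : ℤ_[p]) ^ (n + 1) ∣ a ^ k - 1) : p ^ n ∣ k := by
  rcases eq_or_ne k 0 with rfl | hk0
  · exact dvd_zero _
  obtain ⟨e, m, hm, rfl⟩ := Nat.exists_eq_pow_mul_and_not_dvd hk0 p (by omega)
  have hpa : (p : ℤ_[p]) ∣ a - 1 := ⟨b, ha⟩
  have ha1 : ¬ (p : ℤ_[p]) ∣ a := fun h =>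
    PadicInt.prime_p.not_isUnit (isUnit_of_dvd_one (by simpa using dvd_sub h hpa))
  have hm' : ¬ (p : ℤ_[p]) ∣ (m : ℤ_[p]) := by
    rwa [← toZMod_eq_zero_iff_dvd, map_natCast, ZMod.natCast_eq_zero_iff]
  have hodd : Odd p := (Fact.out : p.Prime).odd_of_ne_two (by omega)
  have h1 := emultiplicity_pow_prime_pow_sub_pow_prime_pow (PadicInt.prime_p (p := p)) hodd hpa
    ha1 e
  have h2 := emultiplicity_pow_sub_pow_of_prime (PadicInt.prime_p (p := p))
    (x := a ^ p ^ e) (y := 1 ^ p ^ e) (hpa.trans (sub_dvd_pow_sub_pow _ _ _))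
    (fun h => ha1 (PadicInt.prime_p.dvd_of_dvd_pow h)) hm'
  have h3 : emultiplicity (p : ℤ_[p]) (a - 1) = 1 := by
    have := (isUnit_iff_not_dvd b).mp hb
    rw [ha, emultiplicity_mul PadicInt.prime_p, emultiplicity_eq_zero.mpr this, add_zero]
    exact_mod_cast (FiniteMultiplicity.emultiplicity_self
      (FiniteMultiplicity.of_prime_left PadicInt.prime_p (NeZero.ne _)))
  rw [pow_dvd_iff_le_emultiplicity, pow_mul] at h
  simp only [one_pow] at h1 h2
  rw [h2, h1, h3] at h
  refine (pow_dvd_pow p ?_).trans (dvd_mul_right _ _)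
  have h4 : ((n + 1 : ℕ) : ℕ∞) ≤ ((1 + e : ℕ) : ℕ∞) := by exact_mod_cast h
  have := ENat.natCast_le_natCast.mp h4
  omega

theorem galois_pow_apply {u : ℤ_[p]⟦X⟧} (hu0 : coeff 0 u = 0) {υ : Gal(PadicAlgCl p/ℚ_[p])}
    {x : PadicAlgCl p} (hx : ‖x‖ < 1) (hυ : υ x = ev x u) (k : ℕ) :
    (υ ^ k) x = ev x (iter u k) := by
  induction k with
  | zero => simp [iter]
  | succ k ih =>
    rw [pow_succ, AlgEquiv.mul_apply, hυ, galois_ev _ hx, ih, ev_iter_succ' hu0 _ hx]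

namespace IsHeightOne

variable {f A B : ℤ_[p]⟦X⟧} (hf : IsHeightOne f A B)

include hf

/-- Total ramification: the residue field of `ℚ_p(x)` is `𝔽_p`. -/
theorem exists_norm_sub_lt_one {n : ℕ} {x y : PadicAlgCl p} (hx : x ∈ Prim f n)
    (hy : y ∈ IntermediateField.adjoin ℚ_[p] {x}) (hy1 : ‖y‖ ≤ 1) :
    ∃ c : ℤ_[p], ‖y - algebraMap ℤ_[p] (PadicAlgCl p) c‖ < 1 := by
  obtain ⟨r, rfl⟩ := exists_aeval_eq_of_norm_le_one (hf.norm_pow_of_mem_prim hx)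
    (hf.natDegree_minpoly hx) hy hy1
  exact ⟨r.coeff 0, (norm_aeval_sub_coeff_zero_le hx.1.le r).trans_lt hx.1⟩

/-- The integers of `ℚ_p(x)` are `ℤ_p[x]`, so the displacement of the generator bounds all others.
-/
theorem norm_galois_sub_le {n : ℕ} {x y : PadicAlgCl p} (hx : x ∈ Prim f n)
    (hy : y ∈ IntermediateField.adjoin ℚ_[p] {x}) (hy1 : ‖y‖ ≤ 1)
    (σ : Gal(PadicAlgCl p/ℚ_[p])) : ‖σ y - y‖ ≤ ‖σ x - x‖ := by
  obtain ⟨r, rfl⟩ := exists_aeval_eq_of_norm_le_one (hf.norm_pow_of_mem_prim hx)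
    (hf.natDegree_minpoly hx) hy hy1
  have h : σ (Polynomial.aeval x r) = Polynomial.aeval (σ x) r :=
    (Polynomial.aeval_algHom_apply (σ.toAlgHom.restrictScalars ℤ_[p]) x r).symm
  rw [h]
  exact norm_aeval_sub_aeval_le (by rw [norm_galois]; exact hx.1.le) hx.1.le r

end IsHeightOne

theorem galois_algebraMap (σ : Gal(PadicAlgCl p/ℚ_[p])) (c : ℤ_[p]) :
    σ (algebraMap ℤ_[p] (PadicAlgCl p) c) = algebraMap ℤ_[p] (PadicAlgCl p) c :=
  σ.commutes (c : ℚ_[p])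

theorem norm_pow_sub_one_lt {s : PadicAlgCl p} (hs : ‖s‖ = 1) {b : ℤ_[p]}
    (hb : ‖s - algebraMap ℤ_[p] (PadicAlgCl p) b‖ < 1) : ‖s ^ (p - 1) - 1‖ < 1 := by
  have hb1 : ‖algebraMap ℤ_[p] (PadicAlgCl p) b‖ = 1 := by
    rw [← hs]
    refine norm_eq_of_norm_sub_lt ?_
    rwa [norm_sub_rev, hs]
  have h1 : ‖s ^ (p - 1) - algebraMap ℤ_[p] (PadicAlgCl p) b ^ (p - 1)‖ < 1 := by
    have h := norm_aeval_sub_aeval_le hs.le hb1.le (Polynomial.X ^ (p - 1))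
    rw [map_pow, map_pow, Polynomial.aeval_X, Polynomial.aeval_X] at h
    exact h.trans_lt hb
  have h2 : ‖algebraMap ℤ_[p] (PadicAlgCl p) b ^ (p - 1) - 1‖ < 1 := by
    rw [← map_pow, ← map_one (algebraMap ℤ_[p] (PadicAlgCl p)), ← map_sub,
      norm_algebraMap_padicInt, PadicInt.norm_lt_one_iff_dvd, ← toZMod_eq_zero_iff_dvd, map_sub,
      map_pow, map_one, ZMod.pow_card_sub_one_eq_one, sub_self]
    rw [Ne, toZMod_eq_zero_iff_dvd, ← isUnit_iff_not_dvd, PadicInt.isUnit_iff,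
      ← norm_algebraMap_padicInt, hb1]
  simpa using norm_add_lt h1 h2

/-! ### Powers and conjugates of the automorphism induced by `u`. -/

namespace IsUnitCommuting

variable {f u A B : ℤ_[p]⟦X⟧} (hu : IsUnitCommuting f u) (hf : IsHeightOne f A B)
  {b : ℤ_[p]} (hb : IsUnit b) (h1 : coeff 1 u - 1 = p * b)

include hu hf hb h1

theorem pow_dvd_of_galois_pow_eq (hp : 2 < p) {n : ℕ} {x : PadicAlgCl p} (hx : x ∈ Prim f n)
    {υ : Gal(PadicAlgCl p/ℚ_[p])} (hυ : υ x = ev x u) {k : ℕ} (hk : (υ ^ k) x = x) :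
    p ^ n ∣ k := by
  rw [galois_pow_apply hu.coeff_zero hx.1 hυ] at hk
  have h := (hu.iter_right hf.coeff_zero k).pow_dvd_coeff_one_sub_one hf hx hk
  rw [coeff_one_iter hu.coeff_zero] at h
  exact pow_dvd_of_pow_dvd_pow_sub_one hp hb h1 h

/-- Write `υ x = x + d x^p` and `σ x = s x`. Up to terms smaller than `‖x‖ ^ p`, the conjugate sends
`x` to `x + σ(d) s^(p-1) x^p`. Both `σ(d) ≡ d` and `s^(p-1) ≡ 1` hold because the residue field is
`𝔽_p`. -/
theorem norm_conj_sub_lt {n : ℕ} {x : PadicAlgCl p} (hx : x ∈ Prim f (n + 1))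
    (hN : ∀ σ : Gal(PadicAlgCl p/ℚ_[p]), σ x ∈ IntermediateField.adjoin ℚ_[p] {x})
    {υ : Gal(PadicAlgCl p/ℚ_[p])} (hυ : υ x = ev x u) (σ : Gal(PadicAlgCl p/ℚ_[p])) :
    ‖(σ * υ * σ⁻¹) x - υ x‖ < ‖x‖ ^ p := by
  have hx0 := hf.norm_pos_of_mem_prim hx
  have hxne : x ≠ 0 := norm_pos_iff.mp hx0
  have hxmem : x ∈ IntermediateField.adjoin ℚ_[p] {x} :=
    IntermediateField.mem_adjoin_simple_self ℚ_[p] x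
  have hδ : ‖υ x - x‖ = ‖x‖ ^ p := hυ ▸ hu.norm_ev_sub_self hf hb h1 hx
  set t := σ⁻¹ x / x with ht
  set s := σ x / x with hs
  set d := (υ x - x) / x ^ p with hd
  have ht1 : ‖t‖ = 1 := by rw [ht, norm_div, norm_galois, div_self hx0.ne']
  have hs1 : ‖s‖ = 1 := by rw [hs, norm_div, norm_galois, div_self hx0.ne']
  have hd1 : ‖d‖ = 1 := by rw [hd, norm_div, norm_pow, hδ, div_self (pow_pos hx0 p).ne']
  obtain ⟨a, ha⟩ := hf.exists_norm_sub_lt_one hx (div_mem (hN σ) hxmem) hs1.le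
  obtain ⟨c, hc⟩ := hf.exists_norm_sub_lt_one hx
    (div_mem (sub_mem (hN υ) hxmem) (pow_mem hxmem p)) hd1.le
  have htx : σ⁻¹ x = t * x := by rw [ht, div_mul_cancel₀ _ hxne]
  have hsx : σ x = s * x := by rw [hs, div_mul_cancel₀ _ hxne]
  have hdx : υ x = x + d * x ^ p := by
    rw [hd, div_mul_cancel₀ _ (pow_ne_zero p hxne)]
    ring
  have hσt : σ t * s = 1 := by
    have h : σ (σ⁻¹ x) = x := by rw [← AlgEquiv.mul_apply, mul_inv_cancel, AlgEquiv.one_apply]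
    rw [htx, map_mul, hsx] at h
    apply mul_right_cancel₀ hxne
    linear_combination h
  have hυt : ‖υ t - t‖ ≤ ‖x‖ ^ p :=
    hδ ▸ hf.norm_galois_sub_le hx (div_mem (hN σ⁻¹) hxmem) ht1.le υ
  have hps : s ^ p = s ^ (p - 1) * s := by
    rw [← pow_succ, Nat.sub_add_cancel (Fact.out : p.Prime).one_le]
  -- The integer `c` lifts the residue class of `d`. The last term is negligible, since `υ` moves
  -- the unit `t` by at most `‖x‖ ^ p` and `‖υ x‖ < 1`.
  have key : (σ * υ * σ⁻¹) x - υ x =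
      (σ d * (s ^ (p - 1) - 1) + (σ d - algebraMap ℤ_[p] (PadicAlgCl p) c) -
        (d - algebraMap ℤ_[p] (PadicAlgCl p) c)) * x ^ p + σ ((υ t - t) * υ x) := by
    have e1 : (σ * υ * σ⁻¹) x = σ (υ t * υ x) := by
      rw [AlgEquiv.mul_apply, AlgEquiv.mul_apply, htx, map_mul υ]
    have e2 : υ t * υ x = t * x + t * (d * x ^ p) + (υ t - t) * υ x := by
      rw [hdx]
      ring
    have e3 : σ (t * x) = x := by
      rw [map_mul, hsx]
      linear_combination x * hσt
    have e4 : σ (t * (d * x ^ p)) = σ d * s ^ (p - 1) * x ^ p := by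
      rw [map_mul, map_mul, map_pow, hsx, mul_pow, hps]
      linear_combination σ d * s ^ (p - 1) * x ^ p * hσt
    rw [e1, e2, map_add, map_add, e3, e4, hdx]
    ring
  rw [key]
  refine norm_add_lt ?_ ?_
  · rw [norm_mul, norm_pow]
    refine mul_lt_of_lt_one_left (pow_pos hx0 p) (norm_sub_lt (norm_add_lt ?_ ?_) hc)
    · rw [norm_mul, norm_galois, hd1, one_mul]
      exact norm_pow_sub_one_lt hs1 ha
    · rw [← galois_algebraMap σ, ← map_sub, norm_galois]
      exact hc
  · rw [norm_galois, norm_mul, norm_galois]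
    calc _ ≤ ‖x‖ ^ p * ‖x‖ := mul_le_mul_of_nonneg_right hυt hx0.le
      _ < ‖x‖ ^ p := mul_lt_of_lt_one_right (pow_pos hx0 p) hx.1

/-- Conjugation acts trivially on the wild inertia modulo `p`-th powers. -/
theorem dvd_of_conj_eq {n : ℕ} {x : PadicAlgCl p} (hx : x ∈ Prim f (n + 1))
    (hN : ∀ σ : Gal(PadicAlgCl p/ℚ_[p]), σ x ∈ IntermediateField.adjoin ℚ_[p] {x})
    {υ : Gal(PadicAlgCl p/ℚ_[p])} (hυ : υ x = ev x u) (σ : Gal(PadicAlgCl p/ℚ_[p])) {a : ℕ}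
    (ha : (σ * υ * σ⁻¹) x = (υ ^ (a + 1)) x) : p ∣ a := by
  by_contra hpa
  have h2 := hu.norm_conj_sub_lt hf hb h1 hx hN hυ σ
  rw [ha, pow_succ', AlgEquiv.mul_apply, ← map_sub, norm_galois,
    galois_pow_apply hu.coeff_zero hx.1 hυ] at h2
  -- For `p ∤ a` the iterate `u^{∘a}` also has multiplier minus one equal to `p` times a unit, so it
  -- moves `x` by exactly `‖x‖ ^ p`.
  obtain ⟨c, hc, hc1⟩ := exists_pow_sub_one_eq hb h1 hpa
  refine h2.ne ((hu.iter_right hf.coeff_zero a).norm_ev_sub_self hf hc ?_ hx)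
  rw [coeff_one_iter hu.coeff_zero, hc1]

end IsUnitCommuting

end CommutingPair

namespace CommutingPair

/-! ### Compact groups with a tame and a wild generator -/

theorem nonempty_iInter_of_antitone {D : Type*} [TopologicalSpace D] [CompactSpace D]
    (S : ℕ → Set D) (hS : Antitone S) (hne : ∀ n, (S n).Nonempty) (hcl : ∀ n, IsClosed (S n)) :
    ∃ d, ∀ n, d ∈ S n := by
  obtain ⟨d, hd⟩ := IsCompact.nonempty_iInter_of_sequence_nonempty_isCompact_isClosed S
    (fun n => hS n.le_succ) hne (hcl 0).isCompact hcl
  exact ⟨d, Set.mem_iInter.mp hd⟩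

/-- A continuous bijective homomorphism from a compact group to a Hausdorff group is an
isomorphism of topological groups. -/
noncomputable def continuousMulEquivOfBijective {D A : Type*} [Group D] [TopologicalSpace D]
    [CompactSpace D] [Group A] [TopologicalSpace A] [T2Space A] (φ : D →* A) (hφ : Continuous φ)
    (hb : Function.Bijective φ) : D ≃ₜ* A where
  __ := MulEquiv.ofBijective φ hb
  continuous_toFun := hφ
  continuous_invFun :=
    (Continuous.homeoOfEquivCompactToT2 (f := Equiv.ofBijective φ hb) hφ).continuous_invFun

section Graph

variable {A G : Type*} [Group A] [TopologicalSpace A] [IsTopologicalGroup A]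
  [Group G] [TopologicalSpace G] [IsTopologicalGroup G]

theorem isClosed_setOf_mem_iff_mem {U : Subgroup A} {V : Subgroup G} (hU : IsOpen (U : Set A))
    (hV : IsOpen (V : Set G)) : IsClosed {d : A × G | d.1 ∈ U ↔ d.2 ∈ V} := by
  have hU' : IsClopen (U : Set A) := ⟨U.isClosed_of_isOpen hU, hU⟩
  have hV' : IsClopen (V : Set G) := ⟨V.isClosed_of_isOpen hV, hV⟩
  have h : {d : A × G | d.1 ∈ U ↔ d.2 ∈ V} =
      ((U : Set A) ×ˢ (V : Set G)) ∪ ((U : Set A)ᶜ ×ˢ (V : Set G)ᶜ) := by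
    ext d
    simp only [Set.mem_ofPred_eq, Set.mem_union, Set.mem_prod, SetLike.mem_coe, Set.mem_compl_iff]
    tauto
  rw [h]
  exact (hU'.1.prod hV'.1).union (hU'.compl.1.prod hV'.compl.1)

/-- Two compact groups which are completions of the same group for corresponding filtrations are
isomorphic. -/
theorem exists_continuousMulEquiv_of_filtrations [CompactSpace A] [T2Space A] [CompactSpace G]
    [T2Space G] {M : Type*} [Group M] (α : M →* A) (β : M →* G) (U : ℕ → Subgroup A)
    (V : ℕ → Subgroup G) (hU : ∀ n, IsOpen (U n : Set A)) (hV : ∀ n, IsOpen (V n : Set G))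
    (hUa : Antitone U) (hVa : Antitone V) (hU1 : ∀ a, (∀ n, a ∈ U n) → a = 1)
    (hV1 : ∀ g, (∀ n, g ∈ V n) → g = 1) (hα : ∀ n a, ∃ m, (α m)⁻¹ * a ∈ U n)
    (hβ : ∀ n g, ∃ m, (β m)⁻¹ * g ∈ V n) (h : ∀ n m, α m ∈ U n ↔ β m ∈ V n) :
    ∃ φ : G ≃ₜ* A, ∀ m, φ (β m) = α m := by
  -- `D` is the closure of the correspondence `α m ↔ β m`. Equality of filtration conditions is
  -- closed, so it persists on `D`; separation makes both projections injective, density and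
  -- compactness make them surjective.
  let D : Subgroup (A × G) := (α.prod β).range.topologicalClosure
  have hDm : ∀ m, (α m, β m) ∈ D := fun m => Subgroup.le_topologicalClosure _ ⟨m, rfl⟩
  have hDcl : IsClosed (D : Set (A × G)) := Subgroup.isClosed_topologicalClosure _
  have : CompactSpace D := isCompact_iff_compactSpace.mp hDcl.isCompact
  have hD : ∀ d ∈ D, ∀ n, d.1 ∈ U n ↔ d.2 ∈ V n := by
    intro d hd n
    have hcl := isClosed_setOf_mem_iff_mem (hU n) (hV n)
    refine closure_minimal ?_ hcl hd
    rintro _ ⟨m, rfl⟩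
    exact h n m
  let φ₁ : D →* A := (MonoidHom.fst A G).comp D.subtype
  let φ₂ : D →* G := (MonoidHom.snd A G).comp D.subtype
  have hc₁ : Continuous φ₁ := continuous_fst.comp continuous_subtype_val
  have hc₂ : Continuous φ₂ := continuous_snd.comp continuous_subtype_val
  have hb₁ : Function.Bijective φ₁ := by
    constructor
    · refine (injective_iff_map_eq_one φ₁).mpr fun d hd => ?_
      have h1 : d.1.1 = 1 := hd
      have h2 : d.1.2 = 1 := hV1 _ fun n => (hD d.1 d.2 n).mp (h1 ▸ (U n).one_mem)
      exact Subtype.ext (Prod.ext h1 h2)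
    · intro a
      obtain ⟨d, hd⟩ := nonempty_iInter_of_antitone (fun n => {d : D | (φ₁ d)⁻¹ * a ∈ U n})
        (fun m n hmn d hd => hUa hmn hd)
        (fun n => (hα n a).imp' (fun m => ⟨_, hDm m⟩) fun m hm => hm)
        (fun n => ((U n).isClosed_of_isOpen (hU n)).preimage (hc₁.inv.mul continuous_const))
      exact ⟨d, inv_mul_eq_one.mp (hU1 _ hd)⟩
  have hb₂ : Function.Bijective φ₂ := by
    constructor
    · refine (injective_iff_map_eq_one φ₂).mpr fun d hd => ?_
      have h2 : d.1.2 = 1 := hd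
      have h1 : d.1.1 = 1 := hU1 _ fun n => (hD d.1 d.2 n).mpr (h2 ▸ (V n).one_mem)
      exact Subtype.ext (Prod.ext h1 h2)
    · intro g
      obtain ⟨d, hd⟩ := nonempty_iInter_of_antitone (fun n => {d : D | (φ₂ d)⁻¹ * g ∈ V n})
        (fun m n hmn d hd => hVa hmn hd)
        (fun n => (hβ n g).imp' (fun m => ⟨_, hDm m⟩) fun m hm => hm)
        (fun n => ((V n).isClosed_of_isOpen (hV n)).preimage (hc₂.inv.mul continuous_const))
      exact ⟨d, inv_mul_eq_one.mp (hV1 _ hd)⟩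
  let e₁ := continuousMulEquivOfBijective φ₁ hc₁ hb₁
  let e₂ := continuousMulEquivOfBijective φ₂ hc₂ hb₂
  refine ⟨e₂.symm.trans e₁, fun m => ?_⟩
  have h2 : e₂.symm (β m) = ⟨_, hDm m⟩ := by
    rw [ContinuousMulEquiv.symm_apply_eq]
    rfl
  rw [ContinuousMulEquiv.trans_apply, h2]
  rfl

end Graph

/-- A filtration of `G` by open normal subgroups of index `p^n (p-1)`, whose tame quotient
`G / H 0` is cyclic and for which `u` generates `H 0` topologically and is central modulo `p`-th
powers. -/
structure IsTameWild (p : ℕ) {G : Type*} [Group G] [TopologicalSpace G] (H : ℕ → Subgroup G)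
    (u : G) : Prop where
  normal : ∀ n, (H n).Normal
  isOpen : ∀ n, IsOpen (H n : Set G)
  anti : Antitone H
  sep : ∀ g, (∀ n, g ∈ H n) → g = 1
  index : ∀ n, (H n).index = p ^ n * (p - 1)
  mem : u ∈ H 0
  dvd_of_pow_mem : ∀ n k : ℕ, u ^ k ∈ H n → p ^ n ∣ k
  conj : ∀ σ (a : ℕ), (u ^ (a + 1))⁻¹ * (σ * u * σ⁻¹) ∈ H 1 → p ∣ a
  exists_generator : ∃ σ : G, ∀ k : ℕ, σ ^ k ∈ H 0 → p - 1 ∣ k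

theorem coprime_pow_sub_one {p : ℕ} (hp : p.Prime) (n : ℕ) : (p ^ n).Coprime (p - 1) :=
  Nat.Coprime.pow_left n ((Nat.coprime_self_sub_right hp.one_le).mpr (Nat.coprime_one_right p))

theorem mem_of_pow_mem_of_coprime {G : Type*} [Group G] (H : Subgroup G) {g : G} {m n : ℕ}
    (hmn : m.Coprime n) (hm : g ^ m ∈ H) (hn : g ^ n ∈ H) : g ∈ H := by
  have h := Nat.gcd_eq_gcd_ab m n
  rw [Nat.Coprime.gcd_eq_one hmn, Nat.cast_one] at h
  rw [← zpow_one g, h, zpow_add, zpow_mul, zpow_mul, zpow_natCast, zpow_natCast]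
  exact H.mul_mem (H.zpow_mem hm _) (H.zpow_mem hn _)

/-! ### Structure of a group with a tame-wild filtration. -/

namespace IsTameWild

variable {p : ℕ} [hp : Fact p.Prime] {G : Type*} [Group G] [TopologicalSpace G]
  {H : ℕ → Subgroup G} {u : G} (h : IsTameWild p H u)

include h

theorem relIndex (n : ℕ) : (H n).relIndex (H 0) = p ^ n := by
  have h1 := Subgroup.relIndex_mul_index (h.anti (Nat.zero_le n))
  rw [h.index, h.index, pow_zero, one_mul] at h1
  exact Nat.eq_of_mul_eq_mul_right (Nat.sub_pos_of_lt hp.out.one_lt) h1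

theorem pow_mem_of_mem {g : G} (hg : g ∈ H 0) (n : ℕ) : g ^ p ^ n ∈ H n := by
  have := h.normal n
  have h1 := Subgroup.pow_index_mem ((H n).subgroupOf (H 0)) ⟨g, hg⟩
  rw [← Subgroup.relIndex, h.relIndex] at h1
  exact h1

theorem zpow_mem_iff (n : ℕ) (k : ℤ) : u ^ k ∈ H n ↔ ((p ^ n : ℕ) : ℤ) ∣ k := by
  constructor
  · intro hk
    refine Int.natCast_dvd.mpr (h.dvd_of_pow_mem n _ ?_)
    rcases Int.natAbs_eq k with h1 | h1
    · rwa [h1, zpow_natCast] at hk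
    · rw [h1, zpow_neg, zpow_natCast] at hk
      exact (H n).inv_mem_iff.mp hk
  · rintro ⟨c, rfl⟩
    rw [zpow_mul, zpow_natCast]
    exact (H n).zpow_mem (h.pow_mem_of_mem h.mem n) c

theorem exists_pow_mul_mem {g : G} (hg : g ∈ H 0) (n : ℕ) :
    ∃ a : ℕ, (u ^ (a + 1))⁻¹ * g ∈ H n := by
  have := h.normal n
  let N := (H n).subgroupOf (H 0)
  let ū : H 0 ⧸ N := QuotientGroup.mk ⟨u, h.mem⟩
  have hcard : Nat.card (H 0 ⧸ N) = p ^ n := h.relIndex n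
  have : Finite (H 0 ⧸ N) := Nat.finite_of_card_ne_zero (hcard ▸ pow_ne_zero n hp.out.ne_zero)
  have hord : orderOf ū = Nat.card (H 0 ⧸ N) := by
    refine Nat.dvd_antisymm (orderOf_dvd_natCard ū) ?_
    rw [hcard]
    refine h.dvd_of_pow_mem n _ ?_
    have h1 : ((⟨u, h.mem⟩ : H 0) ^ orderOf ū : H 0) ∈ N := by
      rw [← QuotientGroup.eq_one_iff]
      exact pow_orderOf_eq_one ū
    exact h1
  have htop : Subgroup.zpowers ū = ⊤ :=
    Subgroup.eq_top_of_card_eq _ (by rw [Nat.card_zpowers, hord])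
  -- The class of `u` has order `p^n`, so it generates the quotient. Expressing `g u⁻¹` as a power
  -- yields the exponent `a + 1` required by `conj`.
  have hmem : (QuotientGroup.mk ⟨g, hg⟩ : H 0 ⧸ N) * ū⁻¹ ∈ Submonoid.powers ū := by
    rw [mem_powers_iff_mem_zpowers, htop]
    trivial
  obtain ⟨a, ha⟩ := hmem
  refine ⟨a, ?_⟩
  have h2 : (QuotientGroup.mk ((⟨u, h.mem⟩ : H 0) ^ (a + 1)) : H 0 ⧸ N) =
      QuotientGroup.mk ⟨g, hg⟩ := by
    rw [QuotientGroup.mk_pow, pow_succ]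
    exact eq_mul_inv_iff_mul_eq.mp ha
  have h3 := QuotientGroup.eq.mp h2
  exact h3

/-- Modulo `H (n + 1)`, conjugation by `w` raises `u` to the power `a + 1` with `p ∣ a`. Then
`w^(p-1) = 1` gives `p^(n+1) ∣ (a+1)^(p-1) - 1`, which is `a` times a geometric sum congruent to `p
- 1` mod `p`. Hence `p^(n+1) ∣ a`, at every `n`. -/
theorem commute_of_pow_eq_one {w : G} (hw : w ^ (p - 1) = 1) : w * u = u * w := by
  have key : ∀ n, w * u * w⁻¹ * u⁻¹ ∈ H (n + 1) := by
    intro n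
    have := h.normal (n + 1)
    have := h.normal 0
    have hwu : w * u * w⁻¹ ∈ H 0 := Subgroup.Normal.conj_mem ‹_› u h.mem w
    obtain ⟨a, ha⟩ := h.exists_pow_mul_mem hwu (n + 1)
    have hpa : p ∣ a := h.conj w a (h.anti (Nat.le_add_left 1 n) ha)
    have hq : ∀ k : ℕ, (QuotientGroup.mk (w ^ k * u * (w ^ k)⁻¹) : G ⧸ H (n + 1)) =
        QuotientGroup.mk (u ^ (a + 1) ^ k) := by
      intro k
      induction k with
      | zero => simp
      | succ k ih =>
        have e1 : w ^ (k + 1) * u * (w ^ (k + 1))⁻¹ = w * (w ^ k * u * (w ^ k)⁻¹) * w⁻¹ := by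
          rw [pow_succ']
          group
        have e2 : (QuotientGroup.mk (w * u * w⁻¹) : G ⧸ H (n + 1)) =
            QuotientGroup.mk (u ^ (a + 1)) := (QuotientGroup.eq.mpr ha).symm
        rw [e1, QuotientGroup.mk_mul, QuotientGroup.mk_mul, ih, ← QuotientGroup.mk_mul,
          ← QuotientGroup.mk_mul, ← conj_pow, QuotientGroup.mk_pow, e2, ← QuotientGroup.mk_pow,
          ← pow_mul, ← pow_succ']
    have h1 := hq (p - 1)
    rw [hw, one_mul, inv_one, mul_one, QuotientGroup.eq] at h1
    have hpos : 1 ≤ (a + 1) ^ (p - 1) := Nat.one_le_pow _ _ (Nat.succ_pos a)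
    have h2 : u⁻¹ * u ^ (a + 1) ^ (p - 1) = u ^ ((a + 1) ^ (p - 1) - 1) := by
      conv_lhs => rw [← Nat.sub_add_cancel hpos, pow_succ']
      group
    rw [h2] at h1
    have h3 := h.dvd_of_pow_mem _ _ h1
    have h4 : p ^ (n + 1) ∣ a := by
      have h5 : (a + 1) ^ (p - 1) - 1 = (∑ i ∈ Finset.range (p - 1), (a + 1) ^ i) * a := by
        rw [← geom_sum_mul_add, Nat.add_sub_cancel]
      rw [h5] at h3
      refine Nat.Coprime.dvd_of_dvd_mul_left ?_ h3
      refine Nat.Coprime.pow_left _ ((Nat.Prime.coprime_iff_not_dvd hp.out).mpr fun h6 => ?_)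
      rw [← ZMod.natCast_eq_zero_iff] at h6 hpa
      push_cast at h6
      rw [hpa] at h6
      simp only [zero_add, one_pow, Finset.sum_const, Finset.card_range, nsmul_eq_mul,
        mul_one] at h6
      rw [ZMod.natCast_eq_zero_iff] at h6
      exact Nat.not_dvd_of_pos_of_lt (Nat.sub_pos_of_lt hp.out.one_lt)
        (Nat.sub_lt hp.out.pos one_pos) h6
    have h5 : u ^ a ∈ H (n + 1) := by
      rw [← zpow_natCast, h.zpow_mem_iff]
      exact_mod_cast h4
    have h6 : u⁻¹ * (w * u * w⁻¹) ∈ H (n + 1) := by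
      have := (H (n + 1)).mul_mem h5 ha
      rwa [pow_succ', mul_inv_rev, mul_assoc, mul_inv_cancel_left] at this
    have h7 := Subgroup.Normal.conj_mem ‹(H (n + 1)).Normal› _ h6 u
    rwa [← mul_assoc, mul_inv_cancel, one_mul] at h7
  have h8 := h.sep _ fun n => h.anti n.le_succ (key n)
  rw [mul_inv_eq_one, mul_inv_eq_iff_eq_mul] at h8
  exact h8

/-- An element of `H 0` has its `p^n`-th power in `H n`; here its `(p-1)`-th power is also trivial,
and the exponents are coprime. -/
theorem zpow_eq_one_of_mem {w : G} (hw : orderOf w = p - 1) {k : ℤ} (hk : w ^ k ∈ H 0) :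
    w ^ k = 1 := by
  refine h.sep _ fun n => mem_of_pow_mem_of_coprime (H n) (coprime_pow_sub_one hp.out n)
    (h.pow_mem_of_mem hk n) ?_
  rw [← zpow_natCast, ← zpow_mul, mul_comm, zpow_mul, zpow_natCast, ← hw, pow_orderOf_eq_one,
    one_zpow]
  exact (H n).one_mem

/-- A Teichmüller lift: `σ^(p^n)` keeps the class of `σ` modulo `H 0`, because `p^n ≡ 1` mod `p -
1`, and its `(p-1)`-th power lies in `H n`. Compactness supplies a common solution for all `n`. -/
theorem exists_orderOf_eq [IsTopologicalGroup G] [CompactSpace G] :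
    ∃ w : G, orderOf w = p - 1 := by
  obtain ⟨σ, hσ⟩ := h.exists_generator
  have := h.normal
  have hcl : ∀ n, IsClosed (H n : Set G) := fun n => (H n).isClosed_of_isOpen (h.isOpen n)
  have hσ0 : σ ^ (p - 1) ∈ H 0 := by
    have := Subgroup.pow_index_mem (H 0) σ
    rwa [h.index, pow_zero, one_mul] at this
  let S : ℕ → Set G := fun n => {w : G | w ^ (p - 1) ∈ H n ∧ σ⁻¹ * w ∈ H 0}
  have hne : ∀ n, (S n).Nonempty := by
    intro n
    refine ⟨σ ^ p ^ n, ?_, ?_⟩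
    · rw [← pow_mul, ← h.index n]
      exact Subgroup.pow_index_mem (H n) σ
    · have h1 : 1 ≤ p ^ n := Nat.one_le_pow _ _ hp.out.pos
      have h2 : p - 1 ∣ p ^ n - 1 := by simpa using Nat.sub_dvd_pow_sub_pow p 1 n
      obtain ⟨c, hc⟩ := h2
      have h3 : σ⁻¹ * σ ^ p ^ n = (σ ^ (p - 1)) ^ c := by
        rw [← pow_mul, ← hc]
        conv_lhs => rw [← Nat.sub_add_cancel h1, pow_succ']
        group
      rw [h3]
      exact (H 0).pow_mem hσ0 c
  obtain ⟨w, hw⟩ := nonempty_iInter_of_antitone S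
    (fun m n hmn w hw => ⟨h.anti hmn hw.1, hw.2⟩) hne
    fun n => ((hcl n).preimage (continuous_pow _)).inter
      ((hcl 0).preimage (continuous_const.mul continuous_id))
  have hw1 : w ^ (p - 1) = 1 := h.sep _ fun n => (hw n).1
  refine ⟨w, Nat.dvd_antisymm (orderOf_dvd_of_pow_eq_one hw1) (hσ _ ?_)⟩
  have h1 : (QuotientGroup.mk σ : G ⧸ H 0) = QuotientGroup.mk w :=
    QuotientGroup.eq.mpr (hw 0).2
  rw [← QuotientGroup.eq_one_iff, QuotientGroup.mk_pow, h1, ← QuotientGroup.mk_pow,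
    pow_orderOf_eq_one, QuotientGroup.mk_one]

theorem exists_zpow_mul_mem {w : G} (hw : orderOf w = p - 1) (n : ℕ) (g : G) :
    ∃ i j : ℤ, (w ^ i * u ^ j)⁻¹ * g ∈ H n := by
  have := h.normal 0
  let w' : G ⧸ H 0 := QuotientGroup.mk w
  have hcard : Nat.card (G ⧸ H 0) = p - 1 := by
    rw [← Subgroup.index, h.index, pow_zero, one_mul]
  have : Finite (G ⧸ H 0) :=
    Nat.finite_of_card_ne_zero (hcard ▸ (Nat.sub_pos_of_lt hp.out.one_lt).ne')
  have hord : orderOf w' = Nat.card (G ⧸ H 0) := by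
    refine Nat.dvd_antisymm (orderOf_dvd_natCard w') ?_
    rw [hcard, ← hw]
    refine orderOf_dvd_of_pow_eq_one ?_
    rw [← zpow_natCast]
    refine h.zpow_eq_one_of_mem hw ?_
    rw [zpow_natCast, ← QuotientGroup.eq_one_iff]
    exact pow_orderOf_eq_one w'
  have htop : Subgroup.zpowers w' = ⊤ :=
    Subgroup.eq_top_of_card_eq _ (by rw [Nat.card_zpowers, hord])
  obtain ⟨i, hi⟩ : (QuotientGroup.mk g : G ⧸ H 0) ∈ Subgroup.zpowers w' := htop ▸ trivial
  have hi' : (w ^ i)⁻¹ * g ∈ H 0 := QuotientGroup.eq.mp hi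
  obtain ⟨a, ha⟩ := h.exists_pow_mul_mem hi' n
  refine ⟨i, (a + 1 : ℕ), ?_⟩
  rwa [zpow_natCast, mul_inv_rev, mul_assoc]

theorem zpow_mul_zpow_mem_iff {w : G} (hw : orderOf w = p - 1) (n : ℕ) (i j : ℤ) :
    w ^ i * u ^ j ∈ H n ↔ ((p - 1 : ℕ) : ℤ) ∣ i ∧ ((p ^ n : ℕ) : ℤ) ∣ j := by
  rw [← hw, orderOf_dvd_iff_zpow_eq_one, ← h.zpow_mem_iff]
  constructor
  · intro hm
    have h0 : w ^ i ∈ H 0 :=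
      ((H 0).mul_mem_cancel_right ((H 0).zpow_mem h.mem j)).mp (h.anti (Nat.zero_le n) hm)
    have h1 := h.zpow_eq_one_of_mem hw h0
    rw [h1, one_mul] at hm
    exact ⟨h1, hm⟩
  · rintro ⟨h1, h2⟩
    rwa [h1, one_mul]

/-- For `w` of order `p - 1`, the product `w u` works, the two orders modulo `H n` being coprime.
Its restrictions generate the finite-level groups. -/
theorem exists_forall_dvd_of_pow_mem [IsTopologicalGroup G] [CompactSpace G] :
    ∃ g : G, ∀ n k : ℕ, g ^ k ∈ H n → p ^ n * (p - 1) ∣ k := by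
  obtain ⟨w, hw⟩ := h.exists_orderOf_eq
  have hwu : Commute w u := h.commute_of_pow_eq_one (hw ▸ pow_orderOf_eq_one w)
  refine ⟨w * u, fun n k hk => ?_⟩
  rw [hwu.mul_pow, ← zpow_natCast, ← zpow_natCast, h.zpow_mul_zpow_mem_iff hw,
    Int.natCast_dvd_natCast, Int.natCast_dvd_natCast] at hk
  exact (coprime_pow_sub_one hp.out n).mul_dvd_of_dvd_of_dvd hk.2 hk.1

/-- Both sides are completions of `ℤ × ℤ`, through `(i, j) ↦ w^i u^j` and the canonical map, for the
same filtration `p - 1 ∣ i`, `p^n ∣ j`. -/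
theorem exists_continuousMulEquiv [IsTopologicalGroup G] [CompactSpace G] [T2Space G] {w : G}
    (hw : orderOf w = p - 1) :
    ∃ φ : G ≃ₜ* Multiplicative (ZMod (p - 1)) × Multiplicative ℤ_[p],
      φ w = (Multiplicative.ofAdd 1, 1) ∧ φ u = (1, Multiplicative.ofAdd 1) := by
  have hwu : Commute w u := h.commute_of_pow_eq_one (hw ▸ pow_orderOf_eq_one w)
  have : NeZero (p - 1) := ⟨(Nat.sub_pos_of_lt hp.out.one_lt).ne'⟩
  let α : Multiplicative ℤ × Multiplicative ℤ →*
      Multiplicative (ZMod (p - 1)) × Multiplicative ℤ_[p] :=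
    MonoidHom.prodMap (Int.castAddHom (ZMod (p - 1))).toMultiplicative
      (Int.castAddHom ℤ_[p]).toMultiplicative
  let β : Multiplicative ℤ × Multiplicative ℤ →* G :=
    MonoidHom.noncommCoprod (zpowersHom G w) (zpowersHom G u)
      fun i j => (hwu.zpow_zpow i.toAdd j.toAdd)
  have hβ : ∀ m, β m = w ^ m.1.toAdd * u ^ m.2.toAdd := fun m => rfl
  let U : ℕ → Subgroup (Multiplicative (ZMod (p - 1)) × Multiplicative ℤ_[p]) := fun n =>
    (⊥ : Subgroup _).prod
      (AddSubgroup.toSubgroup (Ideal.span {(p : ℤ_[p]) ^ n}).toAddSubgroup)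
  have hU : ∀ n m, m ∈ U n ↔ m.1 = 1 ∧ (p : ℤ_[p]) ^ n ∣ m.2.toAdd := fun n m => by
    rw [← Ideal.mem_span_singleton]
    rfl
  suffices key : ∃ φ : G ≃ₜ* Multiplicative (ZMod (p - 1)) × Multiplicative ℤ_[p],
      ∀ m, φ (β m) = α m by
    obtain ⟨φ, hφ⟩ := key
    refine ⟨φ, ?_, ?_⟩
    · simpa [hβ, α] using hφ (Multiplicative.ofAdd 1, 1)
    · simpa [hβ, α] using hφ (1, Multiplicative.ofAdd 1)
  refine exists_continuousMulEquiv_of_filtrations α β U H (fun n => ?_) h.isOpen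
    (fun k n hkn m hm => ?_) h.anti (fun m hm => ?_) h.sep (fun n m => ?_) (fun n g => ?_)
    (fun n m => ?_)
  · have hop : IsOpen {z : ℤ_[p] | z ∈ Ideal.span {(p : ℤ_[p]) ^ n}} := by
      simp only [← PadicInt.norm_le_pow_iff_mem_span_pow]
      have hpos : (p : ℝ) ^ (-n : ℤ) ≠ 0 := zpow_ne_zero _ (Nat.cast_ne_zero.mpr hp.out.ne_zero)
      have := IsUltrametricDist.isOpen_closedBall (0 : ℤ_[p]) hpos
      simpa [Metric.closedBall, dist_zero_right] using this
    exact (isOpen_discrete {1}).prod hop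
  · rw [hU] at hm ⊢
    exact ⟨hm.1, (pow_dvd_pow _ hkn).trans hm.2⟩
  · simp only [hU] at hm
    refine Prod.ext (hm 0).1 ?_
    by_contra hne
    have hz : m.2.toAdd ≠ 0 := hne
    have h1 := (PadicInt.mem_span_pow_iff_le_valuation _ hz (m.2.toAdd.valuation + 1)).mp
      (Ideal.mem_span_singleton.mpr (hm _).2)
    omega
  · refine ⟨(Multiplicative.ofAdd (m.1.toAdd.val : ℤ),
      Multiplicative.ofAdd (m.2.toAdd.appr n : ℤ)), (hU _ _).mpr ⟨?_, ?_⟩⟩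
    · change -(((m.1.toAdd.val : ℤ) : ZMod (p - 1))) + m.1.toAdd = 0
      simp
    · have h1 := Ideal.mem_span_singleton.mp (PadicInt.appr_spec n m.2.toAdd)
      change (p : ℤ_[p]) ^ n ∣ -(((m.2.toAdd.appr n : ℤ) : ℤ_[p])) + m.2.toAdd
      rwa [Int.cast_natCast, neg_add_eq_sub]
  · obtain ⟨i, j, hij⟩ := h.exists_zpow_mul_mem hw n g
    exact ⟨(Multiplicative.ofAdd i, Multiplicative.ofAdd j), hij⟩
  · rw [hβ, h.zpow_mul_zpow_mem_iff hw, hU]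
    refine and_congr ?_ ?_
    · exact ZMod.intCast_zmod_eq_zero_iff_dvd m.1.toAdd (p - 1)
    · change (p : ℤ_[p]) ^ n ∣ ((m.2.toAdd : ℤ) : ℤ_[p]) ↔ _
      rw [PadicInt.pow_p_dvd_int_iff]
      push_cast
      rfl

end IsTameWild

end CommutingPair

namespace CommutingPair

/-! ### The tower of fields generated by the roots -/

theorem forall_mem_adjoin_apply_eq {F E : Type*} [Field F] [Field E] [Algebra F E] {S : Set E}
    {σ : Gal(E/F)} (h : ∀ x ∈ S, σ x = x) {y : E} (hy : y ∈ IntermediateField.adjoin F S) :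
    σ y = y := by
  induction hy using IntermediateField.adjoin_induction with
  | mem x hx => exact h x hx
  | algebraMap x => exact σ.commutes x
  | add x y _ _ hx hy => rw [map_add, hx, hy]
  | inv x _ hx => rw [map_inv₀, hx]
  | mul x y _ _ hx hy => rw [map_mul, hx, hy]

theorem mem_fixingSubgroup_adjoin_simple {F E : Type*} [Field F] [Field E] [Algebra F E] {x : E}
    {σ : Gal(E/F)} : σ ∈ (IntermediateField.adjoin F {x}).fixingSubgroup ↔ σ x = x := by
  rw [IntermediateField.mem_fixingSubgroup_iff]
  refine ⟨fun h => h x (IntermediateField.mem_adjoin_simple_self F x), fun h y hy => ?_⟩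
  refine forall_mem_adjoin_apply_eq (S := {x}) (fun z hz => ?_) hy
  rwa [Set.mem_singleton_iff.mp hz]

variable {p : ℕ} [Fact p.Prime]

theorem mem_lam_iff {f : ℤ_[p]⟦X⟧} {n : ℕ} {x : PadicAlgCl p} :
    x ∈ Lam f n ↔ ‖x‖ < 1 ∧ ev x (iter f n) = 0 :=
  and_congr_right fun hx => hasValueAt_iff hx

theorem mem_lamAll_of_mem_prim {f : ℤ_[p]⟦X⟧} {n : ℕ} {x : PadicAlgCl p} (hx : x ∈ Prim f n) :
    x ∈ LamAll f :=
  Set.mem_iUnion.mpr ⟨n + 1, mem_lam_iff.mpr ⟨hx.1, hx.2.2⟩⟩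

theorem norm_lt_one_of_mem_lamAll {f : ℤ_[p]⟦X⟧} {x : PadicAlgCl p} (hx : x ∈ LamAll f) :
    ‖x‖ < 1 := by
  obtain ⟨n, hn⟩ := Set.mem_iUnion.mp hx
  exact hn.1

theorem eq_zero_or_mem_prim_of_mem_lam {f : ℤ_[p]⟦X⟧} {n : ℕ} {x : PadicAlgCl p}
    (hx : x ∈ Lam f n) : x = 0 ∨ ∃ k < n, x ∈ Prim f k := by
  rw [mem_lam_iff] at hx
  induction n with
  | zero => exact Or.inl (by simpa [iter] using hx.2)
  | succ n ih =>
    by_cases h : ev x (iter f n) = 0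
    · exact (ih ⟨hx.1, h⟩).imp_right fun ⟨k, hk, hxk⟩ => ⟨k, hk.trans n.lt_succ_self, hxk⟩
    · exact Or.inr ⟨n, n.lt_succ_self, hx.1, h, hx.2⟩

theorem galois_mem_lamAll {f : ℤ_[p]⟦X⟧} (σ : Gal(PadicAlgCl p/ℚ_[p])) {x : PadicAlgCl p}
    (hx : x ∈ LamAll f) : σ x ∈ LamAll f := by
  obtain ⟨n, hn⟩ := Set.mem_iUnion.mp hx
  rw [mem_lam_iff] at hn
  refine Set.mem_iUnion.mpr ⟨n, mem_lam_iff.mpr ⟨by rw [norm_galois]; exact hn.1, ?_⟩⟩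
  rw [← galois_ev σ hn.1, hn.2, map_zero]

instance isGalois_K (f : ℤ_[p]⟦X⟧) : IsGalois ℚ_[p] (K f) := by
  have : Normal ℚ_[p] (K f) := by
    rw [IntermediateField.normal_iff_forall_map_le']
    intro σ
    rw [IntermediateField.adjoin_map]
    refine IntermediateField.adjoin.mono _ _ _ ?_
    rintro _ ⟨x, hx, rfl⟩
    exact galois_mem_lamAll σ hx
  exact ⟨⟩

section Lift

variable {f : ℤ_[p]⟦X⟧}

/-- An extension of an automorphism of `K` to the algebraic closure. -/
noncomputable def liftK (σ : Gal(K f/ℚ_[p])) : Gal(PadicAlgCl p/ℚ_[p]) :=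
  σ.liftNormal (PadicAlgCl p)

theorem liftK_apply (σ : Gal(K f/ℚ_[p])) (y : K f) : liftK σ (y : PadicAlgCl p) = σ y :=
  σ.liftNormal_commutes (PadicAlgCl p) y

theorem liftK_pow_apply (σ : Gal(K f/ℚ_[p])) (k : ℕ) (y : K f) :
    (liftK σ ^ k) (y : PadicAlgCl p) = (σ ^ k) y := by
  induction k generalizing y with
  | zero => simp
  | succ k ih => rw [pow_succ, pow_succ, AlgEquiv.mul_apply, AlgEquiv.mul_apply, liftK_apply, ih]

theorem liftK_inv_apply (σ : Gal(K f/ℚ_[p])) (y : K f) :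
    (liftK σ)⁻¹ (y : PadicAlgCl p) = σ⁻¹ y := by
  apply (liftK σ).injective
  rw [liftK_apply, ← AlgEquiv.mul_apply, ← AlgEquiv.mul_apply, mul_inv_cancel, mul_inv_cancel,
    AlgEquiv.one_apply, AlgEquiv.one_apply]

theorem exists_restrict_apply (σ : Gal(PadicAlgCl p/ℚ_[p])) :
    ∃ τ : Gal(K f/ℚ_[p]), ∀ y : K f, (τ y : PadicAlgCl p) = σ y :=
  ⟨σ.restrictNormal (K f), fun y => σ.restrictNormal_commutes (K f) y⟩

end Lift

theorem IsConsistent.norm_lt_one {f : ℤ_[p]⟦X⟧} {π : ℕ → PadicAlgCl p} (h : IsConsistent f π)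
    (n : ℕ) : ‖π n‖ < 1 :=
  norm_lt_one_of_mem_lamAll (h.mem n)

theorem IsConsistent.ev_succ {f : ℤ_[p]⟦X⟧} {π : ℕ → PadicAlgCl p} (h : IsConsistent f π)
    (n : ℕ) : ev (π (n + 1)) f = π n :=
  (hasValueAt_iff (h.norm_lt_one _)).mp (h.step n)

theorem IsConsistent.mem_prim {f : ℤ_[p]⟦X⟧} {π : ℕ → PadicAlgCl p} (h : IsConsistent f π)
    (h0 : coeff 0 f = 0) (n : ℕ) : π (n + 1) ∈ Prim f n := by
  have key : ∀ m n, ev (π (n + m)) (iter f m) = π n := by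
    intro m
    induction m with
    | zero => simp [iter]
    | succ m ih =>
      intro n
      rw [← add_assoc, ev_iter_succ h0 _ (h.norm_lt_one _), h.ev_succ, ih]
  refine ⟨h.norm_lt_one _, ?_, ?_⟩
  · rw [add_comm, key n 1]
    exact h.one_ne
  · have := key (n + 1) 0
    rwa [zero_add, h.zero] at this

theorem IsHeightOne.exists_isConsistent {f A B : ℤ_[p]⟦X⟧} (hf : IsHeightOne f A B) :
    ∃ π : ℕ → PadicAlgCl p, IsConsistent f π := by
  obtain ⟨x₀, hx₀⟩ := hf.prim_nonempty 0
  choose! next hnext hev using fun (n : ℕ) (x : PadicAlgCl p) (hx : x ∈ Prim f n) =>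
    hf.exists_consistent_succ hx
  let s : ℕ → PadicAlgCl p := fun n => Nat.rec x₀ next n
  have hs : ∀ n, s n ∈ Prim f n := fun n => by
    induction n with
    | zero => exact hx₀
    | succ n ih => exact hnext n _ ih
  have hstep : ∀ n, ev (s (n + 1)) f = s n := fun n => hev n _ (hs n)
  refine ⟨fun n => Nat.casesOn n 0 s, ?_, rfl, ?_, ?_⟩
  · rintro (_ | n)
    · refine Set.mem_iUnion.mpr ⟨0, mem_lam_iff.mpr ⟨by simp, ?_⟩⟩
      simp [iter]
    · exact mem_lamAll_of_mem_prim (hs n)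
  · exact norm_pos_iff.mp (hf.norm_pos_of_mem_prim (hs 0))
  · rintro (_ | n)
    · refine (hasValueAt_iff (hs 0).1).mpr ?_
      have h1 := (hs 0).2.2
      rw [ev_iter_succ hf.coeff_zero _ (hs 0).1] at h1
      simpa [iter] using h1
    · exact (hasValueAt_iff (hs (n + 1)).1).mpr (hstep n)

theorem galois_mem_adjoin {x : PadicAlgCl p}
    (hx : IsGalois ℚ_[p] (IntermediateField.adjoin ℚ_[p] {x})) (σ : Gal(PadicAlgCl p/ℚ_[p])) :
    σ x ∈ IntermediateField.adjoin ℚ_[p] {x} :=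
  IntermediateField.normal_iff_forall_map_le'.mp hx.to_normal σ
    ⟨x, IntermediateField.mem_adjoin_simple_self ℚ_[p] x, rfl⟩

namespace IsHeightOne

variable {f A B : ℤ_[p]⟦X⟧} (hf : IsHeightOne f A B)
  (hGal : ∀ π ∈ LamAll f, IsGalois ℚ_[p] (IntermediateField.adjoin ℚ_[p] {π}))

include hf hGal

/-- Within a level, roots are conjugate and `ℚ_p(x)` is normal; lower levels are reached through
`f(x) ∈ ℚ_p(x)`. -/
theorem mem_adjoin_of_mem_prim {k n : ℕ} (hk : k ≤ n) {x y : PadicAlgCl p} (hx : x ∈ Prim f n)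
    (hy : y ∈ Prim f k) : y ∈ IntermediateField.adjoin ℚ_[p] {x} := by
  induction n generalizing x with
  | zero =>
    obtain rfl := Nat.le_zero.mp hk
    obtain ⟨σ, rfl⟩ := hf.exists_galois_eq hx hy
    exact galois_mem_adjoin (hGal x (mem_lamAll_of_mem_prim hx)) σ
  | succ n ih =>
    rcases hk.eq_or_lt with rfl | hlt
    · obtain ⟨σ, rfl⟩ := hf.exists_galois_eq hx hy
      exact galois_mem_adjoin (hGal x (mem_lamAll_of_mem_prim hx)) σ
    · have h1 := ih (Nat.lt_succ_iff.mp hlt) (ev_mem_prim hf.coeff_zero hx)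
      exact IntermediateField.adjoin_simple_le_iff.mpr (ev_mem_adjoin hx.1 f) h1

theorem Kn_succ_eq {n : ℕ} {x : PadicAlgCl p} (hx : x ∈ Prim f n) :
    Kn f (n + 1) = IntermediateField.adjoin ℚ_[p] {x} := by
  refine le_antisymm (IntermediateField.adjoin_le_iff.mpr fun y hy => ?_)
    (IntermediateField.adjoin_simple_le_iff.mpr (IntermediateField.subset_adjoin _ _
      (mem_lam_iff.mpr ⟨hx.1, hx.2.2⟩)))
  rcases eq_zero_or_mem_prim_of_mem_lam hy with rfl | ⟨k, hk, hyk⟩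
  · exact zero_mem _
  · exact hf.mem_adjoin_of_mem_prim hGal (Nat.lt_succ_iff.mp hk) hx hyk

end IsHeightOne

/-! ### The filtration of `Gal(K/ℚ_p)` by stabilizers along a consistent sequence. -/

section Filtration

variable {f u A B : ℤ_[p]⟦X⟧} {π : ℕ → PadicAlgCl p} (hπ : IsConsistent f π)

/-- The automorphisms of `K` fixing the `n+1`-st term of a consistent sequence. -/
noncomputable def fixer (n : ℕ) : Subgroup Gal(K f/ℚ_[p]) :=
  (IntermediateField.adjoin ℚ_[p] {(⟨π (n + 1), hπ.mem_K (n + 1)⟩ : K f)}).fixingSubgroup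

theorem mem_fixer {n : ℕ} {σ : Gal(K f/ℚ_[p])} :
    σ ∈ fixer hπ n ↔ liftK σ (π (n + 1)) = π (n + 1) := by
  rw [fixer, mem_fixingSubgroup_adjoin_simple, ← Subtype.coe_inj, ← liftK_apply]

theorem mem_fixer_iff_coe {n : ℕ} {σ : Gal(K f/ℚ_[p])} :
    σ ∈ fixer hπ n ↔ (σ ⟨π (n + 1), hπ.mem_K (n + 1)⟩ : PadicAlgCl p) = π (n + 1) := by
  rw [mem_fixer, ← liftK_apply]

theorem isOpen_fixer (n : ℕ) : IsOpen (fixer hπ n : Set Gal(K f/ℚ_[p])) := by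
  have : FiniteDimensional ℚ_[p]
      (IntermediateField.adjoin ℚ_[p] {(⟨π (n + 1), hπ.mem_K (n + 1)⟩ : K f)}) :=
    IntermediateField.adjoin.finiteDimensional (Algebra.IsIntegral.isIntegral _)
  exact IntermediateField.fixingSubgroup_isOpen _

theorem antitone_fixer : Antitone (fixer hπ) := by
  refine antitone_nat_of_succ_le fun n σ hσ => ?_
  rw [mem_fixer] at hσ ⊢
  rw [← hπ.ev_succ (n + 1), galois_ev _ (hπ.norm_lt_one _), hσ]

theorem index_fixer (hf : IsHeightOne f A B) (n : ℕ) :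
    (fixer hπ n).index = p ^ n * (p - 1) := by
  rw [fixer, ← IntermediateField.finrank_eq_fixingSubgroup_index,
    IntermediateField.adjoin.finrank (Algebra.IsIntegral.isIntegral _),
    ← hf.natDegree_minpoly (hπ.mem_prim hf.coeff_zero n),
    ← minpoly.algebraMap_eq (algebraMap (K f) (PadicAlgCl p)).injective]
  rfl

variable (hf : IsHeightOne f A B)
  (hGal : ∀ π ∈ LamAll f, IsGalois ℚ_[p] (IntermediateField.adjoin ℚ_[p] {π}))

include hf hGal

theorem liftK_apply_eq_of_mem_fixer {n : ℕ} {σ : Gal(K f/ℚ_[p])} (hσ : σ ∈ fixer hπ n)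
    {y : PadicAlgCl p} (hy : y ∈ Prim f n) : liftK σ y = y := by
  refine forall_mem_adjoin_apply_eq (S := {π (n + 1)}) (fun z hz => ?_)
    (hf.mem_adjoin_of_mem_prim hGal le_rfl (hπ.mem_prim hf.coeff_zero n) hy)
  rw [Set.mem_singleton_iff.mp hz]
  exact (mem_fixer hπ).mp hσ

theorem normal_fixer (n : ℕ) : (fixer hπ n).Normal := by
  refine ⟨fun σ hσ g => ?_⟩
  rw [mem_fixer_iff_coe, AlgEquiv.mul_apply, AlgEquiv.mul_apply, ← liftK_apply, ← liftK_apply,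
    ← liftK_inv_apply, liftK_apply_eq_of_mem_fixer hπ hf hGal hσ
      (galois_mem_prim _ (hπ.mem_prim hf.coeff_zero n)), ← AlgEquiv.mul_apply, mul_inv_cancel,
    AlgEquiv.one_apply]

theorem eq_one_of_forall_mem_fixer {σ : Gal(K f/ℚ_[p])} (hσ : ∀ n, σ ∈ fixer hπ n) : σ = 1 := by
  ext y
  rw [← liftK_apply, AlgEquiv.one_apply]
  refine forall_mem_adjoin_apply_eq (S := LamAll f) (fun x hx => ?_) y.2
  obtain ⟨n, hn⟩ := Set.mem_iUnion.mp hx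
  rcases eq_zero_or_mem_prim_of_mem_lam hn with rfl | ⟨k, -, hxk⟩
  · exact map_zero _
  · exact liftK_apply_eq_of_mem_fixer hπ hf hGal (hσ k) hxk

/-- The tame character of `Gal(K/ℚ_p)`. -/
theorem exists_tame_character :
    ∃ χ : Gal(K f/ℚ_[p]) →* ZMod p, ∀ σ, χ σ = 1 ↔ σ ∈ fixer hπ 0 := by
  set x := π 1 with hx_def
  have hx : x ∈ Prim f 0 := hπ.mem_prim hf.coeff_zero 0
  have hx0 : ‖x‖ ≠ 0 := (hf.norm_pos_of_mem_prim hx).ne'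
  have hxne : x ≠ 0 := norm_ne_zero_iff.mp hx0
  have hnorm : ∀ σ : Gal(K f/ℚ_[p]), ‖liftK σ x / x‖ = 1 := fun σ => by
    rw [norm_div, norm_galois, div_self hx0]
  have hex : ∀ σ : Gal(K f/ℚ_[p]), ∃ c : ℤ_[p],
      ‖liftK σ x / x - algebraMap ℤ_[p] (PadicAlgCl p) c‖ < 1 := fun σ =>
    hf.exists_norm_sub_lt_one hx
      (div_mem (galois_mem_adjoin (hGal x (mem_lamAll_of_mem_prim hx)) _)
        (IntermediateField.mem_adjoin_simple_self ℚ_[p] x)) (hnorm σ).le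
  choose c hc using hex
  have huniq : ∀ (s : PadicAlgCl p) (a b : ℤ_[p]),
      ‖s - algebraMap ℤ_[p] (PadicAlgCl p) a‖ < 1 →
      ‖s - algebraMap ℤ_[p] (PadicAlgCl p) b‖ < 1 → PadicInt.toZMod a = PadicInt.toZMod b := by
    intro s a b ha hb
    have h1 := norm_sub_lt hb ha
    rw [sub_sub_sub_cancel_left, ← map_sub, norm_algebraMap_padicInt,
      PadicInt.norm_lt_one_iff_dvd, ← toZMod_eq_zero_iff_dvd, map_sub, sub_eq_zero] at h1
    exact h1
  -- Residue `1` means `‖σ x - x‖ < ‖x‖`, which forces `σ x = x` by the spacing of the nonzero roots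
  -- of `f`.
  have hone : ∀ σ : Gal(K f/ℚ_[p]), PadicInt.toZMod (c σ) = 1 ↔ σ ∈ fixer hπ 0 := by
    intro σ
    rw [mem_fixer, zero_add, ← hx_def]
    constructor
    · intro h1
      refine hf.eq_of_mem_prim_zero (galois_mem_prim _ hx) hx ?_
      have h2 : ‖algebraMap ℤ_[p] (PadicAlgCl p) (c σ) - 1‖ < 1 := by
        rw [← map_one (algebraMap ℤ_[p] (PadicAlgCl p)), ← map_sub, norm_algebraMap_padicInt,
          PadicInt.norm_lt_one_iff_dvd, ← toZMod_eq_zero_iff_dvd, map_sub, h1, map_one, sub_self]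
      have h3 := norm_add_lt (hc σ) h2
      rw [sub_add_sub_cancel, div_sub_one hxne, norm_div,
        div_lt_one (hf.norm_pos_of_mem_prim hx)] at h3
      exact h3
    · intro h1
      have h2 := hc σ
      rw [h1, div_self hxne] at h2
      rw [huniq 1 (c σ) 1 h2 (by simp), map_one]
  refine ⟨⟨⟨fun σ => PadicInt.toZMod (c σ), (hone 1).mpr (one_mem _)⟩, fun σ τ => ?_⟩, hone⟩
  change PadicInt.toZMod (c (σ * τ)) = PadicInt.toZMod (c σ) * PadicInt.toZMod (c τ)
  rw [← map_mul]
  refine huniq _ _ _ (hc (σ * τ)) ?_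
  have h1 : liftK (σ * τ) x = liftK σ (liftK τ x) := by
    have e : ∀ ρ : Gal(K f/ℚ_[p]), liftK ρ x = ρ ⟨x, hπ.mem_K 1⟩ := fun ρ =>
      liftK_apply ρ ⟨x, hπ.mem_K 1⟩
    rw [e, e, AlgEquiv.mul_apply, liftK_apply]
  -- The cocycle relation `στx/x = σ(τx/x) · (σx/x)`; it becomes multiplicative modulo the maximal
  -- ideal because `σ` fixes the lift `c τ` in `ℤ_p`.
  have h2 : liftK (σ * τ) x / x - algebraMap ℤ_[p] (PadicAlgCl p) (c σ * c τ) =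
      liftK σ (liftK τ x / x - algebraMap ℤ_[p] (PadicAlgCl p) (c τ)) * (liftK σ x / x) +
        algebraMap ℤ_[p] (PadicAlgCl p) (c τ) *
          (liftK σ x / x - algebraMap ℤ_[p] (PadicAlgCl p) (c σ)) := by
    have hσx : liftK σ x ≠ 0 := by rwa [Ne, map_eq_zero_iff _ (liftK σ).injective]
    rw [h1, map_sub, map_div₀, galois_algebraMap, map_mul]
    field_simp
    ring
  rw [h2]
  refine norm_add_lt ?_ ?_
  · rw [norm_mul, norm_galois, hnorm, mul_one]
    exact hc τ
  · rw [norm_mul]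
    exact (mul_le_of_le_one_left (norm_nonneg _) (norm_algebraMap_le_one _)).trans_lt (hc σ)

/-- The tame character embeds the quotient by `fixer hπ 0` into the multiplicative monoid of the
field `ZMod p`, so this quotient is cyclic. -/
theorem exists_generator_tame :
    ∃ σ : Gal(K f/ℚ_[p]), ∀ k : ℕ, σ ^ k ∈ fixer hπ 0 → p - 1 ∣ k := by
  obtain ⟨χ, hχ⟩ := exists_tame_character hπ hf hGal
  have := normal_fixer hπ hf hGal 0
  have hcard : Nat.card (Gal(K f/ℚ_[p]) ⧸ fixer hπ 0) = p - 1 := by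
    rw [← Subgroup.index, index_fixer hπ hf, pow_zero, one_mul]
  have : Finite (Gal(K f/ℚ_[p]) ⧸ fixer hπ 0) := Nat.finite_of_card_ne_zero
    (hcard ▸ (Nat.sub_pos_of_lt (Fact.out : p.Prime).one_lt).ne')
  let ψ := QuotientGroup.lift (fixer hπ 0) χ fun σ hσ => (hχ σ).mpr hσ
  have hψ : Function.Injective ψ := by
    refine (injective_iff_map_eq_one ψ).mpr fun q => ?_
    induction q using QuotientGroup.induction_on with
    | H σ => exact fun h => (QuotientGroup.eq_one_iff σ).mpr ((hχ σ).mp h)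
  have : IsCyclic (Gal(K f/ℚ_[p]) ⧸ fixer hπ 0) := isCyclic_of_injective_ringHom ψ hψ
  obtain ⟨q, hq⟩ := IsCyclic.exists_ofOrder_eq_natCard (α := Gal(K f/ℚ_[p]) ⧸ fixer hπ 0)
  obtain ⟨σ, rfl⟩ := QuotientGroup.mk_surjective q
  refine ⟨σ, fun k hk => ?_⟩
  rw [← hcard, ← hq]
  refine orderOf_dvd_of_pow_eq_one ?_
  rw [← QuotientGroup.mk_pow]
  exact (QuotientGroup.eq_one_iff _).mpr hk

variable (hu : IsUnitCommuting f u)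

omit hf hGal in
include hu in
theorem actsThrough_iff {σ : Gal(K f/ℚ_[p])} :
    ActsThrough u hπ σ ↔ ∀ n, liftK σ (π (n + 1)) = ev (π (n + 1)) u := by
  constructor
  · intro h n
    rw [(hasValueAt_iff (hπ.norm_lt_one _)).mp (h (n + 1)), ← liftK_apply]
  · rintro h (_ | n)
    · refine (hasValueAt_iff (hπ.norm_lt_one _)).mpr ?_
      rw [← liftK_apply]
      simp only [hπ.zero, map_zero]
      rw [ev_at_zero, hu.coeff_zero, map_zero]
    · refine (hasValueAt_iff (hπ.norm_lt_one _)).mpr ?_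
      rw [← liftK_apply]
      exact (h n).symm

omit hGal in
include hu in
-- On each level `u(π_(n+1))` is a conjugate of `π_(n+1)`. The solution sets decrease since `u`
-- commutes with `f`, and each is a coset of an open subgroup, hence closed; compactness finishes.
theorem exists_actsThrough : ∃ σ : Gal(K f/ℚ_[p]), ActsThrough u hπ σ := by
  let S : ℕ → Set Gal(K f/ℚ_[p]) := fun n => {σ | liftK σ (π (n + 1)) = ev (π (n + 1)) u}
  have hanti : Antitone S := by
    refine antitone_nat_of_succ_le fun n σ hσ => ?_
    have hn := hπ.norm_lt_one (n + 2)
    have hσ' : liftK σ (π (n + 2)) = ev (π (n + 2)) u := hσ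
    change liftK σ (π (n + 1)) = ev (π (n + 1)) u
    rw [← hπ.ev_succ (n + 1), galois_ev _ hn, hσ', hu.comm _ hn]
  have hne : ∀ n, (S n).Nonempty := by
    intro n
    have hx := hπ.mem_prim hf.coeff_zero n
    obtain ⟨σ, hσ⟩ := hf.exists_galois_eq hx (hu.ev_mem_prim hf.coeff_zero hx)
    obtain ⟨τ, hτ⟩ := exists_restrict_apply (f := f) σ
    refine ⟨τ, ?_⟩
    change liftK τ (π (n + 1)) = ev (π (n + 1)) u
    rw [← hσ]
    exact (liftK_apply τ ⟨π (n + 1), hπ.mem_K (n + 1)⟩).trans (hτ _)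
  have hcl : ∀ n, IsClosed (S n) := by
    intro n
    obtain ⟨τ, hτ⟩ := hne n
    have h1 : S n = (fun σ => τ⁻¹ * σ) ⁻¹' (fixer hπ n : Set Gal(K f/ℚ_[p])) := by
      ext σ
      have hτ' : liftK τ (π (n + 1)) = ev (π (n + 1)) u := hτ
      change liftK σ (π (n + 1)) = ev (π (n + 1)) u ↔ τ⁻¹ * σ ∈ fixer hπ n
      rw [mem_fixer_iff_coe, AlgEquiv.mul_apply, ← liftK_inv_apply, ← liftK_apply, ← hτ',
        AlgEquiv.aut_inv, AlgEquiv.symm_apply_eq]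
    rw [h1]
    exact ((fixer hπ n).isClosed_of_isOpen (isOpen_fixer hπ n)).preimage
      (continuous_const.mul continuous_id)
  obtain ⟨σ, hσ⟩ := nonempty_iInter_of_antitone S hanti hne hcl
  exact ⟨σ, (actsThrough_iff hπ hu).mpr hσ⟩

include hu in
theorem eq_of_actsThrough {σ τ : Gal(K f/ℚ_[p])} (hσ : ActsThrough u hπ σ)
    (hτ : ActsThrough u hπ τ) : σ = τ := by
  rw [actsThrough_iff hπ hu] at hσ hτ
  refine (inv_mul_eq_one.mp (eq_one_of_forall_mem_fixer hπ hf hGal fun n => ?_)).symm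
  rw [mem_fixer_iff_coe, AlgEquiv.mul_apply, ← liftK_inv_apply, ← liftK_apply,
    AlgEquiv.aut_inv, AlgEquiv.symm_apply_eq]
  exact (hσ n).trans (hτ n).symm

include hu in
theorem isTameWild (hp : 2 < p) {b : ℤ_[p]} (hb : IsUnit b) (h1 : coeff 1 u - 1 = p * b)
    {υ : Gal(K f/ℚ_[p])} (hυ : ActsThrough u hπ υ) : IsTameWild p (fixer hπ) υ := by
  rw [actsThrough_iff hπ hu] at hυ
  have hprim := hπ.mem_prim hf.coeff_zero
  refine ⟨normal_fixer hπ hf hGal, isOpen_fixer hπ, antitone_fixer hπ,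
    fun g => eq_one_of_forall_mem_fixer hπ hf hGal, index_fixer hπ hf, ?_, fun n k hk => ?_,
    fun σ a ha => ?_, exists_generator_tame hπ hf hGal⟩
  · rw [mem_fixer, hυ, hu.ev_eq_self hf (hprim 0)]
  · refine hu.pow_dvd_of_galois_pow_eq hf hb h1 hp (hprim n) (hυ n) ?_
    rw [mem_fixer_iff_coe, ← liftK_pow_apply] at hk
    exact hk
  · refine hu.dvd_of_conj_eq hf hb h1 (hprim 1)
      (galois_mem_adjoin (hGal _ (hπ.mem 2))) (hυ 1) (liftK σ) ?_
    rw [mem_fixer_iff_coe, AlgEquiv.mul_apply, AlgEquiv.aut_inv] at ha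
    have h2 := (AlgEquiv.symm_apply_eq _).mp (Subtype.ext ha : _ =
      (⟨π (1 + 1), hπ.mem_K (1 + 1)⟩ : K f))
    have h3 := congrArg (Subtype.val : K f → PadicAlgCl p) h2
    rw [← liftK_pow_apply, AlgEquiv.mul_apply, AlgEquiv.mul_apply, ← liftK_apply, ← liftK_apply,
      ← liftK_inv_apply] at h3
    exact h3

theorem isCyclic_gal_Kn {υ : Gal(K f/ℚ_[p])} (h : IsTameWild p (fixer hπ) υ) (n : ℕ) :
    IsGalois ℚ_[p] (Kn f (n + 1)) ∧ IsCyclic Gal(Kn f (n + 1)/ℚ_[p]) ∧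
      Nat.card Gal(Kn f (n + 1)/ℚ_[p]) = p ^ n * (p - 1) := by
  have hx := hπ.mem_prim hf.coeff_zero n
  have hg := hGal _ (hπ.mem (n + 1))
  have hfin := finiteDimensional_adjoin_singleton (π (n + 1))
  have hrank := hf.finrank_adjoin hx
  rw [← hf.Kn_succ_eq hGal hx] at hg hfin hrank
  have hcard : Nat.card Gal(Kn f (n + 1)/ℚ_[p]) = p ^ n * (p - 1) := by
    rw [IsGalois.card_aut_eq_finrank, hrank]
  refine ⟨hg, ?_, hcard⟩
  have hnormal : Normal ℚ_[p] (Kn f (n + 1)) := hg.to_normal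
  obtain ⟨g, hg'⟩ := h.exists_forall_dvd_of_pow_mem
  have hxK : π (n + 1) ∈ Kn f (n + 1) :=
    IntermediateField.subset_adjoin _ _ (mem_lam_iff.mpr ⟨hx.1, hx.2.2⟩)
  refine isCyclic_of_orderOf_eq_card (AlgEquiv.restrictNormalHom (Kn f (n + 1)) (liftK g)) ?_
  refine Nat.dvd_antisymm (orderOf_dvd_natCard _) ?_
  rw [hcard]
  refine hg' n _ ?_
  have h1 := pow_orderOf_eq_one (AlgEquiv.restrictNormalHom (Kn f (n + 1)) (liftK g))
  set k := orderOf (AlgEquiv.restrictNormalHom (Kn f (n + 1)) (liftK g))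
  rw [← map_pow] at h1
  have h2 := (liftK g ^ k).restrictNormal_commutes (Kn f (n + 1)) ⟨π (n + 1), hxK⟩
  have h3 : (liftK g ^ k).restrictNormal (Kn f (n + 1)) = 1 := h1
  rw [h3, AlgEquiv.one_apply] at h2
  rw [mem_fixer_iff_coe, ← liftK_pow_apply]
  exact h2.symm

end Filtration

theorem nonempty_mulEquiv_of_isCyclic {P : Type*} [Group P] [IsCyclic P] {n : ℕ}
    (hcard : Nat.card P = p ^ n * (p - 1)) :
    Nonempty (P ≃* Multiplicative (ZMod (p - 1)) × Multiplicative (ZMod (p ^ n))) := by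
  have hZ : ∀ m, Nat.card (Multiplicative (ZMod m)) = m := fun m =>
    (Nat.card_congr Multiplicative.toAdd).trans (Nat.card_zmod m)
  have : IsCyclic (Multiplicative (ZMod (p - 1)) × Multiplicative (ZMod (p ^ n))) := by
    rw [Group.isCyclic_prod_iff, hZ, hZ]
    exact ⟨inferInstance, inferInstance, (coprime_pow_sub_one Fact.out n).symm⟩
  exact ⟨mulEquivOfCyclicCardEq (by rw [hcard, Nat.card_prod, hZ, hZ, mul_comm])⟩

theorem IsMinimalCommutingPair.isUnitCommuting {f u : ℤ_[p]⟦X⟧} (h : IsMinimalCommutingPair f u)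
    {b : ℤ_[p]} (hb : coeff 1 u - 1 = p * b) : IsUnitCommuting f u where
  coeff_zero := h.u_mem.1
  dvd_sub_one := ⟨b, hb⟩
  comm x hx := by rw [← ev_comp hx _ h.f_mem.1, ← ev_comp hx _ h.u_mem.1, h.comm]

end CommutingPair

theorem mainTheorem2 (p : ℕ) [Fact p.Prime] (hp : 2 < p) (f u : PowerSeries ℤ_[p])
    (hfu : IsMinimalCommutingPair f u)
    (hGal : ∀ π ∈ LamAll f, IsGalois ℚ_[p] (IntermediateField.adjoin ℚ_[p] {π})) :
    -- `K / ℚ_p` is Galois with group topologically isomorphic to `Z_{p-1} × ℤ_p`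
    IsGalois ℚ_[p] (K f) ∧
    Nonempty (Gal(K f/ℚ_[p]) ≃ₜ* Multiplicative (ZMod (p - 1)) × Multiplicative ℤ_[p]) ∧
    (∀ σ τ : Gal(K f/ℚ_[p]), σ * τ = τ * σ) ∧
    -- the finite levels
    (∀ n : ℕ, 1 ≤ n → IsGalois ℚ_[p] (Kn f n) ∧
      Nonempty (Gal(Kn f n/ℚ_[p]) ≃*
        Multiplicative (ZMod (p - 1)) × Multiplicative (ZMod (p ^ (n - 1))))) ∧
    -- the isomorphism is realized by an element of order `p - 1` and the automorphism given by `u`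
    (∃ 𝔴 : Gal(K f/ℚ_[p]), orderOf 𝔴 = p - 1) ∧
    (∃ π : ℕ → PadicAlgCl p, IsConsistent f π) ∧
    (∀ (π : ℕ → PadicAlgCl p) (hπ : IsConsistent f π),
      (∃! 𝔲 : Gal(K f/ℚ_[p]), ActsThrough u hπ 𝔲) ∧
      ∀ 𝔲 𝔴 : Gal(K f/ℚ_[p]), ActsThrough u hπ 𝔲 → orderOf 𝔴 = p - 1 →
        𝔴 * 𝔲 = 𝔲 * 𝔴 ∧
        ∃ φ : Gal(K f/ℚ_[p]) ≃ₜ* Multiplicative (ZMod (p - 1)) × Multiplicative ℤ_[p],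
          φ 𝔴 = (Multiplicative.ofAdd 1, 1) ∧ φ 𝔲 = (1, Multiplicative.ofAdd 1)) := by
  obtain ⟨A, B, hf⟩ := exists_isHeightOne hfu.f_mem.1 hfu.wideg_eq hfu.valuation_f
  obtain ⟨b, hb, h1⟩ := exists_eq_prime_mul_unit
    (hfu.valuation_u.trans (if_neg (by omega : p ≠ 2)))
  have hu := hfu.isUnitCommuting h1
  obtain ⟨π₀, hπ₀⟩ := hf.exists_isConsistent
  obtain ⟨υ₀, hυ₀⟩ := exists_actsThrough hπ₀ hf hu
  -- The assertions not naming a sequence need just one consistent sequence; the final clause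
  -- repeats the argument for an arbitrary one.
  have h₀ := isTameWild hπ₀ hf hGal hu hp hb h1 hυ₀
  obtain ⟨w₀, hw₀⟩ := h₀.exists_orderOf_eq
  obtain ⟨φ₀, -, -⟩ := h₀.exists_continuousMulEquiv hw₀
  refine ⟨isGalois_K f, ⟨φ₀⟩, fun σ τ => ?_, fun n hn => ?_, ⟨w₀, hw₀⟩, ⟨π₀, hπ₀⟩,
    fun π hπ => ⟨?_, fun υ w hυ hw => ?_⟩⟩
  · apply φ₀.injective
    rw [map_mul, map_mul, mul_comm]
  · obtain ⟨n, rfl⟩ := Nat.exists_eq_add_of_le' hn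
    obtain ⟨hg, hc, hcard⟩ := isCyclic_gal_Kn hπ₀ hf hGal h₀ n
    exact ⟨hg, nonempty_mulEquiv_of_isCyclic hcard⟩
  · obtain ⟨υ, hυ⟩ := exists_actsThrough hπ hf hu
    exact ⟨υ, hυ, fun τ hτ => eq_of_actsThrough hπ hf hGal hu hτ hυ⟩
  · have h := isTameWild hπ hf hGal hu hp hb h1 hυ
    exact ⟨h.commute_of_pow_eq_one (hw ▸ pow_orderOf_eq_one w), h.exists_continuousMulEquiv hw⟩
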